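/- **Setting.** Let $\rho:\{0,1,2,\dots\}\to(0,\infty)$ satisfy $\rho(0)=1$, with $\mathcal N_\rho(|z|^2)=\sum_{n\ge 0}|z|^{2n}/\rho(n)$ convergent for every $z\in\mathbb C$. Let $W_\rho:(0,\infty)\to(0,\infty)$ be a measurable function with $\int_0^\infty x^nW_\rho(x)\,dx=\rho(n)$ for all $n\ge0$. Let $H$ be a Hilbert space with orthonormal basis $(|n\rangle)_{n\ge0}$, and put $$|z;\rho\rangle=\mathcal N_\rho(|z|^2)^{-1/2}\sum_{n\ge0}\frac{z^n}{\rho(n)^{1/2}}\,|n\rangle\qquad(z\in\mathbb C).$$ The Bargmann space $\mathcal B(W_\rho)$ is the set of entire functions $F$ with $\int_{\mathbb C}W_\rho(|z|^2)\,|F(z)|^2\,\frac{d^2z}{\pi}<\infty$. For an entire function $f$ with $M(R)=\max_{|z|=R}|f(z)|$, the order is $r=\limsup_{R\to\infty}\frac{\ln\ln M(R)}{\ln R}$ (constants, including $0$, have order $0$) and the type is $s=\limsup_{R\to\infty}\frac{\ln M(R)}{R^r}$. Let $\mathfrak B(r,s)$ [resp. $\mathfrak B_1(r,s)$] be the set of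 entire functions of order $<r$, or of order $r$ and type $\le s$ [resp. $<s$]. A sequence $(z_N)$ of complex numbers with $|z_N|\to\infty$ has density $(t,\delta)$, where $t\in[0,\infty)$ and $\delta\in[0,\infty]$, if, with $n(R)=\#\{N:|z_N|<R\}$, one has $\limsup_{R\to\infty}\frac{\ln n(R)}{\ln R}=t$ and $\lim_{R\to\infty}\frac{n(R)}{R^t}=\delta$. Write $(t,\delta)\succ(t_1,\delta_1)$ if $t>t_1$, or $t=t_1$ and $\delta>\delta_1$. A set $\mathfrak S\subset H$ is undercomplete if some unit vector is orthogonal to all its elements, and total otherwise. A total set $\mathfrak S$ is overcomplete if $\mathfrak S\setminus\{u\}$ is total for at least one $u\in\mathfrak S$. **Proposition.** Suppose that, for some $\mathfrak a,\mathfrak b>0$, $W_\rho(|z|^2)$ is log-asymptotic to $\exp(-2\mathfrak b|z|^{\mathfrak a})$ as $|z|\to\infty$, that is, $\ln W_\rho(|z|^2)/(-2\mathfrak b|z|^{\mathfrak a})\to1$. 1. $\mathfrak B_1(\mathfrak a,\mathfrak b)\subseteq\mathcal B(W_\rho)\subseteq\mathfrak B(\mathfrak a,\mathfrak b)$. Moreover,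 functions of order $\mathfrak a$ and type $\mathfrak b$ may or may not belong to $\mathcal B(W_\rho)$: there is an entire function of order $\mathfrak a$ and type $\mathfrak b$ in $\mathcal B(W_\rho)$, and there is one that is not in $\mathcal B(W_\rho)$. 2. Let $(z_N)$ be a sequence of complex numbers with density $(t,\delta)$. If the $z_N$ are pairwise distinct and $(t,\delta)\succ(\mathfrak a,\mathfrak a\mathfrak b)$, then the set of coherent states $\{|z_N;\rho\rangle\}$ is overcomplete. If $t<\mathfrak a$, then this set is undercomplete. -/

import Mathlib

open Filter Topology MeasureTheory

noncomputable section

namespace Bargmann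

/-! ### Growth of entire functions -/

/-- The maximum modulus `M(R)` of `f` on the circle `|z| = R`. -/
def maxModulus (f : ℂ → ℂ) (R : ℝ) : ℝ :=
  sSup ((fun z : ℂ => ‖f z‖) '' Metric.sphere (0 : ℂ) R)

/-- The order of growth `limsup ln ln M(R) / ln R`, an extended real number.
(A constant function, including `0`, has order `0`.) -/
def growthOrder (f : ℂ → ℂ) : EReal :=
  limsup (fun R : ℝ => ((Real.log (Real.log (maxModulus f R)) / Real.log R : ℝ) : EReal)) atTop

/-- The quantity `limsup ln M(R) / R ^ r`; it is the type of `f` when `f` has order `r`. -/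
def growthType (f : ℂ → ℂ) (r : ℝ) : EReal :=
  limsup (fun R : ℝ => ((Real.log (maxModulus f R) / R ^ r : ℝ) : EReal)) atTop

/-- `𝔅(r, s)`: entire functions of order `< r`, or of order `r` and type `≤ s`. -/
def growthClass (r s : ℝ) : Set (ℂ → ℂ) :=
  {f | Differentiable ℂ f ∧
    (growthOrder f < (r : EReal) ∨
      (growthOrder f = (r : EReal) ∧ growthType f r ≤ (s : EReal)))}

/-- `𝔅₁(r, s)`: entire functions of order `< r`, or of order `r` and type `< s`. -/
def growthClassOne (r s : ℝ) : Set (ℂ → ℂ) :=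
  {f | Differentiable ℂ f ∧
    (growthOrder f < (r : EReal) ∨
      (growthOrder f = (r : EReal) ∧ growthType f r < (s : EReal)))}

/-! ### Density of sequences -/

/-- `n(R)`: the number of terms of the sequence in the disc `|z| < R`. -/
def countingFunction (z : ℕ → ℂ) (R : ℝ) : ℕ :=
  Set.ncard {N : ℕ | ‖z N‖ < R}

/-- The sequence `z` tends to infinity and has density `(t, δ)`. The value `δ = ∞` is allowed. -/
structure HasDensity (z : ℕ → ℂ) (t : ℝ) (δ : EReal) : Prop where
  tendsto_norm : Tendsto (fun N => ‖z N‖) atTop atTop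
  limsup_eq : limsup (fun R : ℝ =>
    ((Real.log (countingFunction z R : ℝ) / Real.log R : ℝ) : EReal)) atTop = (t : EReal)
  tendsto_ratio : Tendsto (fun R : ℝ =>
    (((countingFunction z R : ℝ) / R ^ t : ℝ) : EReal)) atTop (𝓝 δ)

/-- `p ≺ q`: the (strict) lexicographic order of densities. -/
def DensityLT (p q : ℝ × EReal) : Prop :=
  p.1 < q.1 ∨ (p.1 = q.1 ∧ p.2 < q.2)

/-! ### Coherent states and Bargmann spaces -/

/-- The standing assumptions on `ρ`: it is positive, `ρ 0 = 1`, and the normalization series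
`∑ |z| ^ (2 n) / ρ n` converges in the whole complex plane. -/
structure IsAdmissible (ρ : ℕ → ℝ) : Prop where
  pos : ∀ n, 0 < ρ n
  zero_eq_one : ρ 0 = 1
  summable : ∀ z : ℂ, Summable (fun n : ℕ => ‖z‖ ^ (2 * n) / ρ n)

/-- The normalization function `𝒩_ρ(x) = ∑ x ^ n / ρ n`. -/
def normalization (ρ : ℕ → ℝ) (x : ℝ) : ℝ :=
  ∑' n : ℕ, x ^ n / ρ n

/-- The generalized coherent state `|z; ρ⟩`, with respect to the number states `|n⟩ = e n`. -/
def coherentState {H : Type*} [NormedAddCommGroup H] [InnerProductSpace ℂ H]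
    (e : HilbertBasis ℕ ℂ H) (ρ : ℕ → ℝ) (z : ℂ) : H :=
  (((Real.sqrt (normalization ρ (‖z‖ ^ 2)))⁻¹ : ℝ) : ℂ) •
    ∑' n : ℕ, (z ^ n / ((Real.sqrt (ρ n) : ℝ) : ℂ)) • e n

/-- `W` is a weight function `W_ρ` for `ρ`: a positive function on `(0, ∞)` with power
moments `ρ n`. -/
structure IsWeight (ρ : ℕ → ℝ) (W : ℝ → ℝ) : Prop where
  measurable : Measurable W
  pos : ∀ x : ℝ, 0 < x → 0 < W x
  integrableOn : ∀ n : ℕ, IntegrableOn (fun x : ℝ => x ^ n * W x) (Set.Ioi 0)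
  moment : ∀ n : ℕ, ∫ x in Set.Ioi (0 : ℝ), x ^ n * W x = ρ n

/-- `(F, F) = ∫ (d²z / π) W(|z|²) |F(z)|²`, as an extended non-negative number. -/
def bargmannNormSq (W : ℝ → ℝ) (F : ℂ → ℂ) : ENNReal :=
  ∫⁻ z : ℂ, ENNReal.ofReal (W (‖z‖ ^ 2) / Real.pi * ‖F z‖ ^ 2)

/-- The generalized Bargmann space `𝓑(W)`: the entire functions `F` with `(F, F)` finite. -/
def bargmannSpace (W : ℝ → ℝ) : Set (ℂ → ℂ) :=
  {F | Differentiable ℂ F ∧ bargmannNormSq W F < ⊤}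

/-- `f` is log-asymptotic to `g` at infinity: `ln f(R) / ln g(R) → 1`. -/
def LogAsymptotic (f g : ℝ → ℝ) : Prop :=
  Tendsto (fun R : ℝ => Real.log (f R) / Real.log (g R)) atTop (𝓝 1)

/-! ### Total, undercomplete and overcomplete sets of states -/

/-- Some state (unit vector) is orthogonal to every element of `S`. -/
def IsUndercomplete {H : Type*} [NormedAddCommGroup H] [InnerProductSpace ℂ H]
    (S : Set H) : Prop :=
  ∃ s : H, ‖s‖ = 1 ∧ ∀ u ∈ S, inner ℂ u s = 0

/-- No state (unit vector) is orthogonal to every element of `S`. -/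
def IsTotal {H : Type*} [NormedAddCommGroup H] [InnerProductSpace ℂ H]
    (S : Set H) : Prop :=
  ¬ ∃ s : H, ‖s‖ = 1 ∧ ∀ u ∈ S, inner ℂ u s = 0

/-- `S` is total and remains so after the removal of some element. -/
def IsOvercomplete {H : Type*} [NormedAddCommGroup H] [InnerProductSpace ℂ H]
    (S : Set H) : Prop :=
  IsTotal S ∧ ∃ u ∈ S, IsTotal (S \ {u})

end Bargmann

end

/-! Every claim reduces to the size of Taylor coefficients, measured on the scale `kappa a β n`, the
maximum of `R ^ n * exp (-β R ^ a)`. By Cauchy's estimate at the maximizing radius, growth at rate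
`β` forces `‖c n‖ ≤ C / kappa a β n` (`norm_coeff_le_kappa`). Conversely, such coefficients give
growth at every rate `β' > β` (`summable_of_le_kappa`). Changing `β` changes the scale by a
geometric factor `q ^ n`, which absorbs polynomial factors. The weight enters only through its
moments, which lie up to constants between `kappa a b₂ n ^ 2` and `kappa a b₁ n ^ 2` whenever `b₁ <
b < b₂` (`exists_moment_le`, `exists_le_moment`).

The Bargmann norm is morally `∑ ‖c n‖ ^ 2 * ρ n`. Two weak forms of this suffice: each single term
is at most the norm, and the norm is finite if the series converges with an extra factor `(n + 1) ^
2`. This yields both inclusions. For the boundary examples, take `‖c n‖ ^ 2 * ρ n` equal to `(n + 1)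
^ (-4)` or `(n + 1) ^ 2`. Polynomial factors are invisible to order and type, so both functions lie
in the larger class and not in the smaller one, that is, have order `a` and type exactly `b`. The
norm is finite for the first and infinite for the second.

A vector `s` is orthogonal to `|z; ρ⟩` exactly when the entire function with coefficients `⟨s, e n⟩
/ √(ρ n)` vanishes at `z`, and this function grows at every rate `β > b`. With too many zeros,
Jensen's formula contradicts this growth unless `s = 0`, even after one point is discarded
(`eq_zero_of_zeros_of_density`). If `t < a`, a canonical product of growth exponent below `a`
vanishes on the whole sequence, and its coefficients define the orthogonal state
(`exists_entire_vanishing`). -/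

namespace Bargmann

/-! ### The critical coefficient scale for order `a` and type `β` -/

/-- `(n / (e a β)) ^ (n / a)`: the maximum of `R ^ n * exp (-β R ^ a)` over `R > 0`. -/
noncomputable def kappa (a β : ℝ) (n : ℕ) : ℝ :=
  Real.exp (n / a * (Real.log (n / (a * β)) - 1))

lemma kappa_pos (a β : ℝ) (n : ℕ) : 0 < kappa a β n := Real.exp_pos _

lemma kappa_zero (a β : ℝ) : kappa a β 0 = 1 := by simp [kappa]

/-- This is `log x ≤ x - 1` at `x = a β R ^ a / n`; equality holds at `R = (n / (a β)) ^ (1 / a)`,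
the radius of `kappa_eq`. -/
lemma pow_le_kappa_mul_exp {a β : ℝ} (ha : 0 < a) (hβ : 0 < β) (n : ℕ) {R : ℝ} (hR : 0 ≤ R) :
    R ^ n ≤ kappa a β n * Real.exp (β * R ^ a) := by
  rcases hR.eq_or_lt with rfl | hR
  · rcases n.eq_zero_or_pos with rfl | hn
    · simp [kappa_zero, Real.zero_rpow ha.ne']
    · rw [zero_pow hn.ne']
      exact (mul_pos (kappa_pos _ _ _) (Real.exp_pos _)).le
  rcases n.eq_zero_or_pos with rfl | hn
  · simp only [pow_zero, kappa_zero, one_mul]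
    exact Real.one_le_exp (by positivity)
  have hn' : (0 : ℝ) < n := by exact_mod_cast hn
  rw [kappa, ← Real.exp_add, ← Real.exp_log (pow_pos hR n), Real.log_pow]
  apply Real.exp_le_exp.2
  have hRa : 0 < R ^ a := Real.rpow_pos_of_pos hR a
  have h := Real.log_le_sub_one_of_pos (x := a * β * R ^ a / n) (by positivity)
  rw [Real.log_div (by positivity) hn'.ne', Real.log_mul (by positivity) hRa.ne',
    Real.log_rpow hR] at h
  rw [Real.log_div hn'.ne' (by positivity)]
  have h2 := mul_le_mul_of_nonneg_left h (show 0 ≤ n / a by positivity)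
  have e1 : n / a * (a * β * R ^ a / n - 1) = β * R ^ a - n / a := by field_simp
  have e2 : n / a * (a * Real.log R) = n * Real.log R := by field_simp
  rw [e1] at h2
  linear_combination h2 - e2

lemma kappa_eq {a β : ℝ} (ha : 0 < a) (hβ : 0 < β) {n : ℕ} (hn : 0 < n) :
    ((n / (a * β)) ^ a⁻¹ : ℝ) ^ n =
      kappa a β n * Real.exp (β * ((n / (a * β)) ^ a⁻¹ : ℝ) ^ a) := by
  have hn' : (0 : ℝ) < n := by exact_mod_cast hn
  have hx : 0 < n / (a * β) := by positivity
  rw [← Real.rpow_mul hx.le, inv_mul_cancel₀ ha.ne', Real.rpow_one, kappa, ← Real.exp_add,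
    ← Real.rpow_natCast, ← Real.rpow_mul hx.le, Real.rpow_def_of_pos hx]
  congr 1
  field_simp
  ring

/-- The ratio is `(β / β') ^ (n / a)`. This geometric gain is the slack spent in all later
estimates. -/
lemma exists_kappa_ratio {a β β' : ℝ} (ha : 0 < a) (hβ : 0 < β) (h : β < β') :
    ∃ q : ℝ, 0 < q ∧ q < 1 ∧ ∀ n, kappa a β' n = kappa a β n * q ^ n := by
  have hβ' := hβ.trans h
  refine ⟨Real.exp (-(Real.log β' - Real.log β) / a), Real.exp_pos _, ?_, fun n => ?_⟩
  · rw [Real.exp_lt_one_iff]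
    have := Real.log_lt_log hβ h
    exact div_neg_of_neg_of_pos (by linarith) ha
  · rcases n.eq_zero_or_pos with rfl | hn
    · simp [kappa_zero]
    have hn' : (0 : ℝ) < n := by exact_mod_cast hn
    rw [kappa, kappa, ← Real.exp_nat_mul, ← Real.exp_add, Real.log_div hn'.ne' (by positivity),
      Real.log_div hn'.ne' (by positivity), Real.log_mul ha.ne' hβ'.ne',
      Real.log_mul ha.ne' hβ.ne']
    congr 1
    field_simp
    ring

lemma exists_poly_mul_geom_le (k : ℕ) {q : ℝ} (h0 : 0 < q) (h1 : q < 1) :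
    ∃ C : ℝ, 0 < C ∧ ∀ n : ℕ, ((n : ℝ) + 1) ^ k * q ^ n ≤ C := by
  have h := tendsto_pow_const_mul_const_pow_of_abs_lt_one k (r := q) (by rwa [abs_of_pos h0])
  obtain ⟨C, hC⟩ := h.bddAbove_range
  refine ⟨|C| / q + 1, by positivity, fun n => ?_⟩
  have h2 := hC ⟨n + 1, rfl⟩
  simp only [Nat.cast_add, Nat.cast_one] at h2
  have h3 : ((n : ℝ) + 1) ^ k * q ^ n ≤ |C| / q := by
    rw [le_div_iff₀ h0, mul_assoc, ← pow_succ]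
    exact h2.trans (le_abs_self C)
  linarith

/-! ### Power series with coefficients below the critical scale -/

lemma summable_of_le_kappa {a β : ℝ} (ha : 0 < a) (hβ : 0 < β) {c : ℕ → ℂ} {C : ℝ}
    (hc : ∀ n, ‖c n‖ ≤ C / kappa a β n) {β' : ℝ} (h : β < β') :
    ∃ C' : ℝ, 0 < C' ∧ ∀ z : ℂ, Summable (fun n => c n * z ^ n) ∧
      ‖∑' n, c n * z ^ n‖ ≤ C' * Real.exp (β' * ‖z‖ ^ a) := by
  obtain ⟨q, q0, q1, hq⟩ := exists_kappa_ratio ha hβ h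
  have hC : 0 ≤ C := by
    have := (norm_nonneg _).trans (hc 0)
    rwa [kappa_zero, div_one] at this
  have key : ∀ (z : ℂ) n, ‖c n * z ^ n‖ ≤ C * Real.exp (β' * ‖z‖ ^ a) * q ^ n := by
    intro z n
    rw [norm_mul, norm_pow]
    calc ‖c n‖ * ‖z‖ ^ n
        ≤ C / kappa a β n * (kappa a β' n * Real.exp (β' * ‖z‖ ^ a)) :=
          mul_le_mul (hc n) (pow_le_kappa_mul_exp ha (hβ.trans h) n (norm_nonneg z))
            (by positivity) (div_nonneg hC (kappa_pos _ _ _).le)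
      _ = C * Real.exp (β' * ‖z‖ ^ a) * q ^ n := by
          rw [hq n]
          have := (kappa_pos a β n).ne'
          field_simp
  have hg := summable_geometric_of_lt_one q0.le q1
  refine ⟨(C + 1) * (1 - q)⁻¹, mul_pos (by linarith) (inv_pos.2 (by linarith)), fun z => ?_⟩
  have hs := hg.mul_left (C * Real.exp (β' * ‖z‖ ^ a))
  refine ⟨Summable.of_norm_bounded hs (key z), ?_⟩
  calc ‖∑' n, c n * z ^ n‖ ≤ ∑' n, C * Real.exp (β' * ‖z‖ ^ a) * q ^ n :=
        tsum_of_norm_bounded hs.hasSum (key z)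
    _ = C * (1 - q)⁻¹ * Real.exp (β' * ‖z‖ ^ a) := by
        rw [tsum_mul_left, tsum_geometric_of_lt_one q0.le q1]; ring
    _ ≤ _ := by
        have : 0 ≤ (1 - q)⁻¹ := inv_nonneg.2 (by linarith)
        gcongr
        linarith

/-! ### Taylor coefficients of entire functions -/

lemma exists_hasSum_of_differentiable {F : ℂ → ℂ} (hF : Differentiable ℂ F) :
    ∃ c : ℕ → ℂ, ∀ z, HasSum (fun n => c n * z ^ n) (F z) := by
  -- For an entire function the Cauchy series at radius 1 converges on the whole plane.
  have h := hF.hasFPowerSeriesOnBall 0 (R := 1) one_pos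
  refine ⟨fun n => (cauchyPowerSeries F 0 ((1 : NNReal) : ℝ)).coeff n, fun z => ?_⟩
  have h2 := h.hasSum (y := z) (by simp)
  simp only [zero_add, FormalMultilinearSeries.apply_eq_pow_smul_coeff, smul_eq_mul] at h2
  simpa only [mul_comm] using h2

lemma hasFPowerSeriesOnBall_of_hasSum {F : ℂ → ℂ} {c : ℕ → ℂ}
    (h : ∀ z, HasSum (fun n => c n * z ^ n) (F z)) :
    HasFPowerSeriesOnBall F (FormalMultilinearSeries.ofScalars ℂ c) 0 ⊤ where
  r_le := by
    refine le_of_eq (Eq.symm ?_)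
    refine ENNReal.eq_top_of_forall_nnreal_le fun r => ?_
    apply FormalMultilinearSeries.le_radius_of_summable_norm
    have := (h (r : ℂ)).summable.norm
    convert this using 2 with n
    simp
  r_pos := by simp
  hasSum := by
    intro y _
    rw [zero_add]
    simpa only [FormalMultilinearSeries.ofScalars_apply_eq, smul_eq_mul] using h y

lemma differentiable_of_hasSum {F : ℂ → ℂ} {c : ℕ → ℂ}
    (h : ∀ z, HasSum (fun n => c n * z ^ n) (F z)) : Differentiable ℂ F := by
  intro z
  have := (hasFPowerSeriesOnBall_of_hasSum h).analyticAt_of_mem (y := z) (by simp)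
  exact this.differentiableAt

/-- Cauchy's integral over the circle of radius `r`; uniqueness of power series makes the
coefficients independent of `r`. The mean of `‖F‖`, not its maximum, is kept for the later
integration against the weight. -/
lemma norm_coeff_mul_pow_le {F : ℂ → ℂ} {c : ℕ → ℂ}
    (h : ∀ z, HasSum (fun n => c n * z ^ n) (F z)) (n : ℕ) {r : ℝ} (hr : 0 < r) :
    ‖c n‖ * r ^ n ≤ (2 * Real.pi)⁻¹ * ∫ θ in 0..2 * Real.pi, ‖F (circleMap 0 r θ)‖ := by
  have h1 := (hasFPowerSeriesOnBall_of_hasSum h).hasFPowerSeriesAt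
  have h2 := ((differentiable_of_hasSum h).hasFPowerSeriesOnBall 0 (R := ⟨r, hr.le⟩)
    hr).hasFPowerSeriesAt
  have h3 := h1.eq_formalMultilinearSeries h2
  have h4 := norm_cauchyPowerSeries_le F 0 r n
  have h5 : ‖cauchyPowerSeries F 0 r n‖ = ‖c n‖ := by
    have : cauchyPowerSeries F 0 r = FormalMultilinearSeries.ofScalars ℂ c := h3.symm
    rw [this]
    simp
  rw [h5, abs_of_pos hr, inv_pow] at h4
  rwa [← div_eq_mul_inv, le_div_iff₀ (pow_pos hr n)] at h4

lemma norm_coeff_le_of_norm_le {F : ℂ → ℂ} {c : ℕ → ℂ}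
    (h : ∀ z, HasSum (fun n => c n * z ^ n) (F z)) (n : ℕ) {r M : ℝ} (hr : 0 < r)
    (hM : ∀ z : ℂ, ‖z‖ = r → ‖F z‖ ≤ M) : ‖c n‖ * r ^ n ≤ M := by
  refine (norm_coeff_mul_pow_le h n hr).trans ?_
  have hpi := Real.two_pi_pos
  have : ∫ θ in 0..2 * Real.pi, ‖F (circleMap 0 r θ)‖ ≤ ∫ θ in (0 : ℝ)..2 * Real.pi, M := by
    apply intervalIntegral.integral_mono_on hpi.le
    · exact ((differentiable_of_hasSum h).continuous.comp
        (continuous_circleMap 0 r)).norm.intervalIntegrable _ _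
    · exact intervalIntegrable_const
    · intro θ _
      exact hM _ (by simp [abs_of_pos hr])
  rw [intervalIntegral.integral_const, smul_eq_mul, sub_zero] at this
  rw [inv_mul_le_iff₀ hpi]
  exact this

lemma norm_coeff_le_kappa {F : ℂ → ℂ} {c : ℕ → ℂ}
    (h : ∀ z, HasSum (fun n => c n * z ^ n) (F z)) {a β C : ℝ} (ha : 0 < a) (hβ : 0 < β)
    (hF : ∀ z, ‖F z‖ ≤ C * Real.exp (β * ‖z‖ ^ a)) (n : ℕ) :
    ‖c n‖ ≤ C / kappa a β n := by
  rcases n.eq_zero_or_pos with rfl | hn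
  · have h0 : F 0 = c 0 := by
      refine (h 0).unique ?_
      convert hasSum_single (f := fun n => c n * (0 : ℂ) ^ n) 0 ?_ using 1
      · simp
      · intro b hb
        simp [hb]
    have := hF 0
    rw [h0] at this
    simpa [kappa_zero, Real.zero_rpow ha.ne'] using this
  have hn' : (0 : ℝ) < n := by exact_mod_cast hn
  set r : ℝ := (n / (a * β)) ^ a⁻¹ with hr
  have hr0 : 0 < r := by positivity
  have h1 := norm_coeff_le_of_norm_le h n hr0 (M := C * Real.exp (β * r ^ a))
    (fun z hz => by simpa [hz] using hF z)
  rw [hr, kappa_eq ha hβ hn, ← hr, ← mul_assoc] at h1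
  rw [le_div_iff₀ (kappa_pos _ _ _)]
  exact le_of_mul_le_mul_right h1 (Real.exp_pos _)

/-! ### Bargmann norms and Taylor coefficients -/

lemma lintegral_complex_polar {G : ℂ → ENNReal} (hG : Measurable G) :
    ∫⁻ z, G z = ∫⁻ r in Set.Ioi (0 : ℝ), ENNReal.ofReal r *
      ∫⁻ θ in Set.Ioo (-Real.pi) Real.pi, G (circleMap 0 r θ) := by
  rw [← Complex.lintegral_comp_polarCoord_symm, polarCoord_target, Measure.volume_eq_prod,
    setLIntegral_prod]
  · refine setLIntegral_congr_fun measurableSet_Ioi fun r _ => ?_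
    simp only [smul_eq_mul]
    rw [lintegral_const_mul]
    · refine congrArg _ (lintegral_congr fun θ => ?_)
      congr 1
      simp [circleMap, Complex.exp_mul_I]
    · have : Measurable fun θ : ℝ => Complex.polarCoord.symm (r, θ) := by
        simp only [Complex.polarCoord_symm_apply]
        fun_prop
      exact hG.comp this
  · have : Measurable fun p : ℝ × ℝ => Complex.polarCoord.symm p := by
      simp only [Complex.polarCoord_symm_apply]
      fun_prop
    exact (Measurable.smul (ENNReal.measurable_ofReal.comp measurable_fst) (hG.comp this)).aemeasurable

lemma lintegral_Ioi_comp_sq (g : ℝ → ENNReal) :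
    ∫⁻ r in Set.Ioi (0 : ℝ), ENNReal.ofReal (2 * r) * g (r ^ 2) = ∫⁻ x in Set.Ioi (0 : ℝ), g x := by
  have himg : (fun r : ℝ => r ^ 2) '' Set.Ioi 0 = Set.Ioi 0 := by
    ext x
    simp only [Set.mem_image, Set.mem_Ioi]
    constructor
    · rintro ⟨r, hr, rfl⟩
      positivity
    · exact fun hx => ⟨Real.sqrt x, Real.sqrt_pos.2 hx, Real.sq_sqrt hx.le⟩
  have hinj : Set.InjOn (fun r : ℝ => r ^ 2) (Set.Ioi 0) := fun x hx y hy h =>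
    (pow_left_inj₀ (le_of_lt hx) (le_of_lt hy) two_ne_zero).1 h
  have h := lintegral_image_eq_lintegral_abs_deriv_mul measurableSet_Ioi
    (f := fun r : ℝ => r ^ 2) (f' := fun r => 2 * r)
    (fun x _ => (by simpa using hasDerivAt_pow 2 x : HasDerivAt _ _ x).hasDerivWithinAt) hinj g
  rw [himg] at h
  rw [h]
  refine setLIntegral_congr_fun measurableSet_Ioi fun r hr => ?_
  rw [abs_of_nonneg (by have : 0 < r := hr; positivity)]

lemma ofReal_mul_two_pi (x : ℝ) :
    ENNReal.ofReal x * ENNReal.ofReal (2 * Real.pi) =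
      ENNReal.ofReal Real.pi * ENNReal.ofReal (2 * x) := by
  rw [← ENNReal.ofReal_mul' Real.two_pi_pos.le, ← ENNReal.ofReal_mul Real.pi_pos.le]
  congr 1
  ring

lemma lintegral_radial {g : ℝ → ENNReal} (hg : Measurable g) :
    ∫⁻ z : ℂ, g (‖z‖ ^ 2) = ENNReal.ofReal Real.pi * ∫⁻ x in Set.Ioi (0 : ℝ), g x := by
  rw [lintegral_complex_polar (G := fun z => g (‖z‖ ^ 2)) (hg.comp (by fun_prop)),
    ← lintegral_Ioi_comp_sq g, ← lintegral_const_mul _ (by fun_prop)]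
  refine setLIntegral_congr_fun measurableSet_Ioi fun r hr => ?_
  simp only [norm_circleMap_zero, sq_abs, lintegral_const, MeasurableSet.univ,
    Measure.restrict_apply, Set.univ_inter, Real.volume_Ioo, sub_neg_eq_add, ← two_mul]
  rw [mul_comm (g _), ← mul_assoc, ofReal_mul_two_pi, mul_assoc]

lemma lintegral_moment {ρ : ℕ → ℝ} {W : ℝ → ℝ} (hW : IsWeight ρ W) {k : ℝ} (hk : 0 ≤ k) (n : ℕ) :
    ∫⁻ x in Set.Ioi (0 : ℝ), ENNReal.ofReal (k * (x ^ n * W x)) = ENNReal.ofReal (k * ρ n) := by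
  rw [← hW.moment n, ← integral_const_mul, ofReal_integral_eq_lintegral_ofReal]
  · exact (hW.integrableOn n).const_mul k
  · refine (ae_restrict_iff' measurableSet_Ioi).2 (Eventually.of_forall fun x hx => ?_)
    have := hW.pos x hx
    have : (0 : ℝ) < x := hx
    show 0 ≤ k * (x ^ n * W x)
    positivity

/-- One term of Parseval's identity on a circle, deduced from the first-moment bound and `(‖F‖ - m)
^ 2 ≥ 0`. -/
lemma circle_mean_sq_le {F : ℂ → ℂ} {c : ℕ → ℂ}
    (h : ∀ z, HasSum (fun n => c n * z ^ n) (F z)) (n : ℕ) {r : ℝ} (hr : 0 < r) :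
    ENNReal.ofReal (2 * Real.pi * (‖c n‖ * r ^ n) ^ 2) ≤
      ∫⁻ θ in Set.Ioo (-Real.pi) Real.pi, ENNReal.ofReal (‖F (circleMap 0 r θ)‖ ^ 2) := by
  have hpi := Real.two_pi_pos
  have hcont : Continuous fun θ => ‖F (circleMap 0 r θ)‖ :=
    ((differentiable_of_hasSum h).continuous.comp (continuous_circleMap 0 r)).norm
  set m : ℝ := ‖c n‖ * r ^ n with hm
  have hm0 : 0 ≤ m := by positivity
  have h1 : 2 * Real.pi * m ≤ ∫ θ in 0..2 * Real.pi, ‖F (circleMap 0 r θ)‖ := by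
    have := norm_coeff_mul_pow_le h n hr
    rwa [le_inv_mul_iff₀ hpi] at this
  have h2 : 2 * Real.pi * m ^ 2 ≤ ∫ θ in 0..2 * Real.pi, ‖F (circleMap 0 r θ)‖ ^ 2 := by
    have h3 : ∫ θ in 0..2 * Real.pi, (2 * m * ‖F (circleMap 0 r θ)‖ - m ^ 2) ≤
        ∫ θ in 0..2 * Real.pi, ‖F (circleMap 0 r θ)‖ ^ 2 := by
      apply intervalIntegral.integral_mono_on hpi.le
      · exact ((hcont.const_mul (2 * m)).sub continuous_const).intervalIntegrable _ _
      · exact (hcont.pow 2).intervalIntegrable _ _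
      · intro θ _
        nlinarith [sq_nonneg (‖F (circleMap 0 r θ)‖ - m)]
    rw [intervalIntegral.integral_sub ((hcont.const_mul (2 * m)).intervalIntegrable _ _)
      intervalIntegrable_const, intervalIntegral.integral_const_mul,
      intervalIntegral.integral_const, smul_eq_mul, sub_zero] at h3
    nlinarith [mul_le_mul_of_nonneg_left h1 hm0]
  -- Cauchy's formula uses angles in `[0, 2π]`, polar coordinates use `(-π, π)`.
  have hper : Function.Periodic (fun θ => ‖F (circleMap 0 r θ)‖ ^ 2) (2 * Real.pi) := fun θ => by
    simp only [periodic_circleMap 0 r θ]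
  have h4 := hper.intervalIntegral_add_eq 0 (-Real.pi)
  rw [zero_add, show -Real.pi + 2 * Real.pi = Real.pi by ring] at h4
  rw [h4, intervalIntegral.integral_of_le (by linarith), integral_Ioc_eq_integral_Ioo] at h2
  rw [← ofReal_integral_eq_lintegral_ofReal]
  · exact ENNReal.ofReal_le_ofReal h2
  · exact ((hcont.pow 2).integrableOn_Icc (a := -Real.pi) (b := Real.pi)).mono_set
      Set.Ioo_subset_Icc_self
  · exact Eventually.of_forall fun θ => sq_nonneg _

lemma norm_coeff_sq_mul_le_bargmannNormSq {ρ : ℕ → ℝ} {W : ℝ → ℝ} (hW : IsWeight ρ W)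
    {F : ℂ → ℂ} {c : ℕ → ℂ} (h : ∀ z, HasSum (fun n => c n * z ^ n) (F z)) (n : ℕ) :
    ENNReal.ofReal (‖c n‖ ^ 2 * ρ n) ≤ bargmannNormSq W F := by
  have hWm := hW.measurable
  have hFm : Measurable F := (differentiable_of_hasSum h).continuous.measurable
  rw [bargmannNormSq, lintegral_complex_polar (by fun_prop), ← lintegral_moment hW (sq_nonneg _) n,
    ← lintegral_Ioi_comp_sq]
  refine setLIntegral_mono' measurableSet_Ioi fun r hr => ?_
  have hr' : 0 < r := hr
  have hw := hW.pos (r ^ 2) (by positivity)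
  simp only [norm_circleMap_zero, sq_abs]
  have hw2 : 0 ≤ W (r ^ 2) / Real.pi := by positivity
  simp only [ENNReal.ofReal_mul hw2]
  rw [lintegral_const_mul _ (by fun_prop)]
  refine le_trans (le_of_eq ?_) (mul_le_mul_right (mul_le_mul_right (circle_mean_sq_le h n hr') _) _)
  rw [← ENNReal.ofReal_mul hw2, ← ENNReal.ofReal_mul hr'.le, ← ENNReal.ofReal_mul (by positivity)]
  congr 1
  rw [mul_pow, ← pow_mul, ← pow_mul, mul_comm n 2]
  field_simp

/-- Cauchy–Schwarz against `(n + 1)⁻¹` bounds `‖F z‖ ^ 2` by a series in `‖z‖ ^ (2 n)`, which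
integrates termwise. The factor `(n + 1) ^ 2` is the price of not using orthogonality of the
monomials. -/
lemma bargmannNormSq_lt_top {ρ : ℕ → ℝ} {W : ℝ → ℝ} (hW : IsWeight ρ W)
    {F : ℂ → ℂ} {c : ℕ → ℂ} (h : ∀ z, HasSum (fun n => c n * z ^ n) (F z))
    (hs : Summable fun n : ℕ => ((n : ℝ) + 1) ^ 2 * ‖c n‖ ^ 2 * ρ n) :
    bargmannNormSq W F < ⊤ := by
  have hWm := hW.measurable
  have hS : Summable fun n : ℕ => (((n : ℝ) + 1)⁻¹) ^ 2 := by
    have := (summable_nat_add_iff 1).2 (Real.summable_nat_pow_inv (p := 2).2 one_lt_two)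
    simpa using this
  set S : ℝ := ∑' n : ℕ, (((n : ℝ) + 1)⁻¹) ^ 2 with hSdef
  have hS0 : 0 ≤ S := tsum_nonneg fun n => sq_nonneg _
  have key : ∀ z : ℂ, ENNReal.ofReal (‖F z‖ ^ 2) ≤
      ∑' n : ℕ, ENNReal.ofReal (S * (((n : ℝ) + 1) ^ 2 * ‖c n‖ ^ 2) * (‖z‖ ^ 2) ^ n) := by
    intro z
    have ht : Tendsto (fun N => ENNReal.ofReal (‖∑ n ∈ Finset.range N, c n * z ^ n‖ ^ 2)) atTop
        (𝓝 (ENNReal.ofReal (‖F z‖ ^ 2))) :=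
      (ENNReal.continuous_ofReal.tendsto _).comp ((h z).tendsto_sum_nat.norm.pow 2)
    refine le_of_tendsto' ht fun N => ?_
    refine le_trans ?_ (ENNReal.sum_le_tsum (Finset.range N))
    rw [← ENNReal.ofReal_sum_of_nonneg fun n _ => by positivity]
    apply ENNReal.ofReal_le_ofReal
    calc ‖∑ n ∈ Finset.range N, c n * z ^ n‖ ^ 2
        ≤ (∑ n ∈ Finset.range N, ((n : ℝ) + 1)⁻¹ * (((n : ℝ) + 1) * (‖c n‖ * ‖z‖ ^ n))) ^ 2 := by
          gcongr
          refine (norm_sum_le _ _).trans (Finset.sum_le_sum fun n _ => ?_)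
          rw [norm_mul, norm_pow, inv_mul_cancel_left₀ (by positivity)]
      _ ≤ (∑ n ∈ Finset.range N, (((n : ℝ) + 1)⁻¹) ^ 2) *
          ∑ n ∈ Finset.range N, (((n : ℝ) + 1) * (‖c n‖ * ‖z‖ ^ n)) ^ 2 :=
          Finset.sum_mul_sq_le_sq_mul_sq _ _ _
      _ ≤ S * ∑ n ∈ Finset.range N, (((n : ℝ) + 1) * (‖c n‖ * ‖z‖ ^ n)) ^ 2 := by
          gcongr
          exact hS.sum_le_tsum _ fun n _ => sq_nonneg _
      _ = _ := by
          rw [Finset.mul_sum]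
          refine Finset.sum_congr rfl fun n _ => ?_
          ring
  -- Nothing is known about the sign of `W 0`, so the origin is discarded as a null set.
  have hW0 : ∀ᵐ z : ℂ, 0 ≤ W (‖z‖ ^ 2) := by
    have : ∀ᵐ z : ℂ, z ≠ 0 := by simp [ae_iff]
    filter_upwards [this] with z hz
    exact (hW.pos _ (by positivity)).le
  have hle : bargmannNormSq W F ≤ ∫⁻ z : ℂ, ∑' n : ℕ, ENNReal.ofReal
      (S * (((n : ℝ) + 1) ^ 2 * ‖c n‖ ^ 2) / Real.pi * ((‖z‖ ^ 2) ^ n * W (‖z‖ ^ 2))) := by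
    refine lintegral_mono_ae ?_
    filter_upwards [hW0] with z hz
    have hz' : 0 ≤ W (‖z‖ ^ 2) / Real.pi := by positivity
    rw [ENNReal.ofReal_mul hz']
    refine (mul_le_mul_right (key z) _).trans (le_of_eq ?_)
    rw [← ENNReal.tsum_mul_left]
    refine tsum_congr fun n => ?_
    rw [← ENNReal.ofReal_mul hz']
    congr 1
    ring
  refine hle.trans_lt ?_
  rw [lintegral_tsum fun n => by fun_prop]
  have heq : ∀ n : ℕ, ∫⁻ z : ℂ, ENNReal.ofReal
      (S * (((n : ℝ) + 1) ^ 2 * ‖c n‖ ^ 2) / Real.pi * ((‖z‖ ^ 2) ^ n * W (‖z‖ ^ 2))) =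
      ENNReal.ofReal (S * (((n : ℝ) + 1) ^ 2 * ‖c n‖ ^ 2 * ρ n)) := by
    intro n
    rw [lintegral_radial (g := fun x => ENNReal.ofReal
      (S * (((n : ℝ) + 1) ^ 2 * ‖c n‖ ^ 2) / Real.pi * (x ^ n * W x))) (by fun_prop),
      lintegral_moment hW (by positivity), ← ENNReal.ofReal_mul Real.pi_pos.le]
    congr 1
    field_simp
  simp_rw [heq]
  exact (hs.mul_left S).tsum_ofReal_lt_top

/-! ### Moments of weights log-asymptotic to `exp (-2 b R ^ a)` -/

lemma eventually_weight_le {W : ℝ → ℝ} (hpos : ∀ x : ℝ, 0 < x → 0 < W x) {a b b₁ : ℝ} (hb : 0 < b)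
    (h : LogAsymptotic (fun R : ℝ => W (R ^ 2)) (fun R : ℝ => Real.exp (-2 * b * R ^ a)))
    (hb₁ : b₁ < b) : ∀ᶠ R : ℝ in atTop, W (R ^ 2) ≤ Real.exp (-2 * b₁ * R ^ a) := by
  have h1 : b₁ / b < 1 := by rwa [div_lt_one hb]
  filter_upwards [h.eventually (lt_mem_nhds h1), eventually_gt_atTop 0] with R hR hR0
  have hRa := Real.rpow_pos_of_pos hR0 a
  -- The denominator `-2 b R ^ a` is negative, so a lower bound on the ratio is an upper bound on
  -- the weight.
  rw [Real.log_exp, lt_div_iff_of_neg (by nlinarith [mul_pos hb hRa])] at hR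
  rw [← Real.log_le_iff_le_exp (hpos _ (by positivity))]
  have e : b₁ / b * (-2 * b * R ^ a) = -2 * b₁ * R ^ a := by field_simp
  linarith

lemma eventually_le_weight {W : ℝ → ℝ} (hpos : ∀ x : ℝ, 0 < x → 0 < W x) {a b b₁ : ℝ} (hb : 0 < b)
    (h : LogAsymptotic (fun R : ℝ => W (R ^ 2)) (fun R : ℝ => Real.exp (-2 * b * R ^ a)))
    (hb₁ : b < b₁) : ∀ᶠ R : ℝ in atTop, Real.exp (-2 * b₁ * R ^ a) ≤ W (R ^ 2) := by
  have h1 : 1 < b₁ / b := by rwa [one_lt_div hb]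
  filter_upwards [h.eventually (gt_mem_nhds h1), eventually_gt_atTop 0] with R hR hR0
  have hRa := Real.rpow_pos_of_pos hR0 a
  rw [Real.log_exp, div_lt_iff_of_neg (by nlinarith [mul_pos hb hRa])] at hR
  rw [← Real.le_log_iff_exp_le (hpos _ (by positivity))]
  have e : b₁ / b * (-2 * b * R ^ a) = -2 * b₁ * R ^ a := by field_simp
  linarith

lemma exists_pos_mul_le_of_eventually_le {f g : ℕ → ℝ} (hf : ∀ n, 0 < f n) (hg : ∀ n, 0 < g n)
    (h : ∀ᶠ n in atTop, f n ≤ g n) : ∃ c : ℝ, 0 < c ∧ ∀ n, c * f n ≤ g n := by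
  have : IsBoundedUnder (· ≤ ·) atTop fun n => f n / g n :=
    ⟨1, by
      rw [eventually_map]
      filter_upwards [h] with n hn
      exact (div_le_one (hg n)).2 hn⟩
  obtain ⟨C, hC⟩ := this.bddAbove_range
  have hC' : ∀ n, f n ≤ C * g n := fun n => by
    have := hC ⟨n, rfl⟩
    rwa [div_le_iff₀ (hg n)] at this
  have hC0 : 0 < C := pos_of_mul_pos_left ((hf 0).trans_le (hC' 0)) (hg 0).le
  refine ⟨C⁻¹, inv_pos.2 hC0, fun n => ?_⟩
  rw [inv_mul_le_iff₀ hC0]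
  exact hC' n

lemma sqrt_rpow_eq {x : ℝ} (hx : 0 ≤ x) (a : ℝ) : (Real.sqrt x) ^ a = x ^ (a / 2) := by
  rw [Real.sqrt_eq_rpow, ← Real.rpow_mul hx]
  congr 1
  ring

/-- For small `x` the exponential is bounded and the zeroth moment is finite; for large `x` the
weight decays at a rate `b₂` with `b₁ < b₂ < b`. -/
lemma lintegral_weight_mul_exp_lt_top {ρ : ℕ → ℝ} {W : ℝ → ℝ} (hW : IsWeight ρ W) {a b b₁ : ℝ}
    (ha : 0 < a) (hb : 0 < b) (hb₁ : 0 < b₁)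
    (h : LogAsymptotic (fun R : ℝ => W (R ^ 2)) (fun R : ℝ => Real.exp (-2 * b * R ^ a)))
    (hlt : b₁ < b) :
    ∫⁻ x in Set.Ioi (0 : ℝ), ENNReal.ofReal (Real.exp (2 * b₁ * Real.sqrt x ^ a) * W x) < ⊤ := by
  obtain ⟨b₂, h12, h2⟩ := exists_between hlt
  obtain ⟨R₀, hR₀⟩ := eventually_atTop.1 (eventually_weight_le hW.pos hb h h2)
  have hWm := hW.measurable
  set M := Real.exp (2 * b₁ * |R₀| ^ a) with hM
  have hd : 0 < 2 * (b₂ - b₁) := by linarith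
  have hint := integrableOn_rpow_mul_exp_neg_mul_rpow (p := a / 2) (s := 0) (b := 2 * (b₂ - b₁))
    (by norm_num) (by positivity) hd
  have hW0 : IntegrableOn (fun x => M * W x) (Set.Ioi 0) := by
    have := (hW.integrableOn 0).const_mul M
    simpa [IntegrableOn] using this
  have hsum := hW0.add hint
  refine lt_of_le_of_lt ?_ hsum.lintegral_lt_top
  refine setLIntegral_mono' measurableSet_Ioi fun x hx => ENNReal.ofReal_le_ofReal ?_
  have hx0 : (0 : ℝ) < x := hx
  have hWx := hW.pos x hx
  simp only [Pi.add_apply, Real.rpow_zero, one_mul]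
  have hs := Real.sqrt_nonneg x
  rcases le_total (Real.sqrt x) |R₀| with hle | hle
  · have : Real.exp (2 * b₁ * Real.sqrt x ^ a) ≤ M := by
      rw [hM]
      gcongr
    have := mul_le_mul_of_nonneg_right this hWx.le
    have := Real.exp_pos (-(2 * (b₂ - b₁)) * x ^ (a / 2))
    linarith
  · have h3 := hR₀ (Real.sqrt x) ((le_abs_self _).trans hle)
    rw [Real.sq_sqrt hx0.le] at h3
    have h4 : Real.exp (2 * b₁ * Real.sqrt x ^ a) * W x ≤
        Real.exp (-(2 * (b₂ - b₁)) * x ^ (a / 2)) := by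
      refine (mul_le_mul_of_nonneg_left h3 (Real.exp_pos _).le).trans (le_of_eq ?_)
      rw [← Real.exp_add, sqrt_rpow_eq hx0.le]
      congr 1
      ring
    have := mul_pos (Real.exp_pos (2 * b₁ * |R₀| ^ a)) hWx
    linarith

lemma exists_moment_le {ρ : ℕ → ℝ} {W : ℝ → ℝ} (hW : IsWeight ρ W) {a b b₁ : ℝ}
    (ha : 0 < a) (hb : 0 < b) (hb₁ : 0 < b₁)
    (h : LogAsymptotic (fun R : ℝ => W (R ^ 2)) (fun R : ℝ => Real.exp (-2 * b * R ^ a)))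
    (hlt : b₁ < b) : ∃ C : ℝ, 0 < C ∧ ∀ n, ρ n ≤ C * kappa a b₁ n ^ 2 := by
  have hfin := lintegral_weight_mul_exp_lt_top hW ha hb hb₁ h hlt
  set K := ∫⁻ x in Set.Ioi (0 : ℝ), ENNReal.ofReal (Real.exp (2 * b₁ * Real.sqrt x ^ a) * W x)
  have hWm := hW.measurable
  refine ⟨K.toReal + 1, by positivity, fun n => ?_⟩
  have h1 : ENNReal.ofReal (ρ n) ≤ ENNReal.ofReal (kappa a b₁ n ^ 2 * K.toReal) := by
    rw [ENNReal.ofReal_mul (by positivity), ENNReal.ofReal_toReal hfin.ne,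
      ← lintegral_const_mul' _ _ ENNReal.ofReal_ne_top]
    have := lintegral_moment hW zero_le_one n
    simp only [one_mul] at this
    rw [← this]
    refine setLIntegral_mono' measurableSet_Ioi fun x hx => ?_
    have hx0 : (0 : ℝ) < x := hx
    rw [← ENNReal.ofReal_mul (by positivity), ← mul_assoc]
    refine ENNReal.ofReal_le_ofReal (mul_le_mul_of_nonneg_right ?_ (hW.pos x hx).le)
    have h2 := pow_le_kappa_mul_exp ha hb₁ n (Real.sqrt_nonneg x)
    have h3 := pow_le_pow_left₀ (by positivity) h2 2
    rw [← pow_mul, mul_comm n 2, pow_mul, Real.sq_sqrt hx0.le, mul_pow, ← Real.exp_nat_mul] at h3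
    convert h3 using 3
    push_cast
    ring
  rw [ENNReal.ofReal_le_ofReal_iff (mul_nonneg (sq_nonneg _) ENNReal.toReal_nonneg)] at h1
  nlinarith [sq_nonneg (kappa a b₁ n)]

/-- Only the part of the moment over `(R ^ 2, R ^ 2 + 1]` is kept, where `R` is the radius attaining
`kappa a b₁ n`. There `√x ≤ R + 1`, and an intermediate rate `b < b₂ < b₁` pays for the shift from
`R` to `R + 1`. -/
lemma exists_le_moment {ρ : ℕ → ℝ} {W : ℝ → ℝ} (hρ : ∀ n, 0 < ρ n) (hW : IsWeight ρ W) {a b b₁ : ℝ}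
    (ha : 0 < a) (hb : 0 < b)
    (h : LogAsymptotic (fun R : ℝ => W (R ^ 2)) (fun R : ℝ => Real.exp (-2 * b * R ^ a)))
    (hlt : b < b₁) : ∃ c : ℝ, 0 < c ∧ ∀ n, c * kappa a b₁ n ^ 2 ≤ ρ n := by
  refine exists_pos_mul_le_of_eventually_le (fun n => pow_pos (kappa_pos _ _ _) 2) hρ ?_
  obtain ⟨b₂, h2, h21⟩ := exists_between hlt
  have hb₂ := hb.trans h2
  have hb₁ := hb.trans hlt
  obtain ⟨R₀, hR₀⟩ := eventually_atTop.1 (eventually_le_weight hW.pos hb h h2)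
  have hRn : Tendsto (fun n : ℕ => ((n : ℝ) / (a * b₁)) ^ a⁻¹) atTop atTop :=
    (tendsto_rpow_atTop (inv_pos.2 ha)).comp
      (tendsto_natCast_atTop_atTop.atTop_div_const (by positivity))
  have hquot : Tendsto (fun R : ℝ => (1 + R⁻¹) ^ a) atTop (𝓝 1) := by
    have h1 : Tendsto (fun R : ℝ => 1 + R⁻¹) atTop (𝓝 1) := by
      simpa using tendsto_inv_atTop_zero.const_add (1 : ℝ)
    simpa using h1.rpow_const (p := a) (Or.inl one_ne_zero)
  have hev : ∀ᶠ R : ℝ in atTop, (1 + R⁻¹) ^ a ≤ b₁ / b₂ :=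
    (hquot.eventually (gt_mem_nhds (by rwa [one_lt_div hb₂]))).mono fun _ => le_of_lt
  filter_upwards [hRn.eventually hev, hRn.eventually (eventually_ge_atTop R₀),
    hRn.eventually (eventually_gt_atTop 0), eventually_gt_atTop 0] with n hn1 hn2 hn3 hn
  set R : ℝ := ((n : ℝ) / (a * b₁)) ^ a⁻¹ with hR
  have hkap := kappa_eq ha hb₁ hn
  rw [← hR] at hkap
  have hR1 : b₂ * (R + 1) ^ a ≤ b₁ * R ^ a := by
    have e : R + 1 = R * (1 + R⁻¹) := by field_simp
    rw [e, Real.mul_rpow hn3.le (by positivity)]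
    rw [le_div_iff₀ hb₂] at hn1
    nlinarith [Real.rpow_pos_of_pos hn3 a]
  have hk2 : kappa a b₁ n ^ 2 = (R ^ 2) ^ n * Real.exp (-2 * b₁ * R ^ a) := by
    rw [← pow_mul, mul_comm 2 n, pow_mul, hkap, mul_pow, ← Real.exp_nat_mul, mul_assoc,
      ← Real.exp_add]
    have : ((2 : ℕ) : ℝ) * (b₁ * R ^ a) + -2 * b₁ * R ^ a = 0 := by push_cast; ring
    rw [this, Real.exp_zero, mul_one]
  have hsub : Set.Ioc (R ^ 2) (R ^ 2 + 1) ⊆ Set.Ioi 0 := fun x hx =>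
    (by positivity : (0 : ℝ) < R ^ 2).trans hx.1
  rw [← hW.moment n]
  have hint := hW.integrableOn n
  calc kappa a b₁ n ^ 2 = ∫ x in Set.Ioc (R ^ 2) (R ^ 2 + 1), kappa a b₁ n ^ 2 := by
        simp
    _ ≤ ∫ x in Set.Ioc (R ^ 2) (R ^ 2 + 1), x ^ n * W x := by
        refine setIntegral_mono_on (by simp) (hint.mono_set hsub) measurableSet_Ioc fun x hx => ?_
        have hx0 : 0 < x := hsub hx
        rw [hk2]
        have hs1 : R ≤ Real.sqrt x := Real.le_sqrt_of_sq_le hx.1.le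
        have hs2 : Real.sqrt x ≤ R + 1 := by
          rw [Real.sqrt_le_left (by positivity)]
          nlinarith [hx.2]
        have h5 := hR₀ (Real.sqrt x) (hn2.trans hs1)
        rw [Real.sq_sqrt hx0.le] at h5
        have h6 : Real.exp (-2 * b₁ * R ^ a) ≤ Real.exp (-2 * b₂ * Real.sqrt x ^ a) := by
          apply Real.exp_le_exp.2
          have : Real.sqrt x ^ a ≤ (R + 1) ^ a := Real.rpow_le_rpow (Real.sqrt_nonneg x) hs2 ha.le
          nlinarith
        have hx1 := hx.1.le
        exact mul_le_mul (pow_le_pow_left₀ (by positivity) hx1 n) (h6.trans h5)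
          (Real.exp_pos _).le (by positivity)
    _ ≤ ∫ x in Set.Ioi 0, x ^ n * W x := by
        refine setIntegral_mono_set hint ?_ (Eventually.of_forall hsub)
        refine (ae_restrict_iff' measurableSet_Ioi).2 (Eventually.of_forall fun x hx => ?_)
        have := hW.pos x hx
        have : (0 : ℝ) < x := hx
        show 0 ≤ x ^ n * W x
        positivity

/-! ### Order and type in terms of exponential bounds -/

lemma norm_le_maxModulus {F : ℂ → ℂ} (hF : Continuous F) (z : ℂ) : ‖F z‖ ≤ maxModulus F ‖z‖ :=
  le_csSup ((isCompact_sphere 0 ‖z‖).image hF.norm).bddAbove ⟨z, by simp, rfl⟩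

lemma maxModulus_le {F : ℂ → ℂ} {R M : ℝ} (hR : 0 ≤ R) (h : ∀ z : ℂ, ‖z‖ = R → ‖F z‖ ≤ M) :
    maxModulus F R ≤ M := by
  refine csSup_le ((NormedSpace.sphere_nonempty.2 hR).image _) ?_
  rintro _ ⟨z, hz, rfl⟩
  exact h z (by simpa using hz)

lemma maxModulus_nonneg (F : ℂ → ℂ) (R : ℝ) : 0 ≤ maxModulus F R := by
  refine Real.sSup_nonneg ?_
  rintro _ ⟨z, _, rfl⟩
  exact norm_nonneg _

lemma exists_norm_le_of_eventually_maxModulus_le {F : ℂ → ℂ} (hF : Continuous F) {a β : ℝ}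
    (hβ : 0 < β) (h : ∀ᶠ R in atTop, maxModulus F R ≤ Real.exp (β * R ^ a)) :
    ∃ C : ℝ, 0 < C ∧ ∀ z, ‖F z‖ ≤ C * Real.exp (β * ‖z‖ ^ a) := by
  obtain ⟨R₀, hR₀⟩ := eventually_atTop.1 h
  obtain ⟨M, hM⟩ := (isCompact_closedBall (0 : ℂ) R₀).exists_bound_of_continuousOn hF.continuousOn
  refine ⟨|M| + 1, by positivity, fun z => ?_⟩
  have h1 : 1 ≤ Real.exp (β * ‖z‖ ^ a) := Real.one_le_exp (by positivity)
  rcases le_total ‖z‖ R₀ with hz | hz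
  · have := (hM z (by simpa using hz)).trans (le_abs_self M)
    nlinarith [abs_nonneg M]
  · have := (norm_le_maxModulus hF z).trans (hR₀ _ hz)
    nlinarith [abs_nonneg M]

lemma eventually_le_of_growthOrder_lt {F : ℂ → ℂ} {a β : ℝ} (hβ : 0 < β)
    (h : growthOrder F < (a : EReal)) :
    ∀ᶠ R in atTop, maxModulus F R ≤ Real.exp (β * R ^ a) := by
  obtain ⟨r, hr1, hr2⟩ := EReal.lt_iff_exists_real_btwn.1 h
  have hra : r < a := EReal.coe_lt_coe_iff.1 hr2
  have hlim : Tendsto (fun R : ℝ => R ^ (-(a - r))) atTop (𝓝 0) :=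
    tendsto_rpow_neg_atTop (by linarith)
  filter_upwards [eventually_lt_of_limsup_lt hr1, eventually_gt_atTop 1,
    hlim.eventually (gt_mem_nhds hβ)] with R hR hR1 hR2
  have hR0 : 0 < R := by linarith
  have hlog : 0 < Real.log R := Real.log_pos hR1
  rw [EReal.coe_lt_coe_iff, div_lt_iff₀ hlog] at hR
  have hRa := Real.rpow_pos_of_pos hR0 a
  -- For modulus at most 1 the iterated `Real.log` carries no information, but the bound is trivial.
  rcases le_or_gt (maxModulus F R) 1 with hM | hM
  · exact hM.trans (Real.one_le_exp (by positivity))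
  · have hM0 : 0 < maxModulus F R := by linarith
    have hl : 0 < Real.log (maxModulus F R) := Real.log_pos hM
    rw [← Real.log_le_iff_le_exp hM0]
    rw [← Real.log_rpow hR0, Real.log_lt_log_iff hl (Real.rpow_pos_of_pos hR0 r)] at hR
    have e : R ^ r = R ^ (-(a - r)) * R ^ a := by
      rw [← Real.rpow_add hR0]; congr 1; ring
    rw [e] at hR
    nlinarith

lemma eventually_le_of_growthType_lt {F : ℂ → ℂ} {a β : ℝ} (h : growthType F a < (β : EReal)) :
    ∀ᶠ R in atTop, maxModulus F R ≤ Real.exp (β * R ^ a) := by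
  filter_upwards [eventually_lt_of_limsup_lt h, eventually_gt_atTop 0] with R hR hR0
  have hRa := Real.rpow_pos_of_pos hR0 a
  rw [EReal.coe_lt_coe_iff, div_lt_iff₀ hRa] at hR
  rcases (maxModulus_nonneg F R).eq_or_lt with h0 | h0
  · rw [← h0]
    exact (Real.exp_pos _).le
  · rw [← Real.log_le_iff_le_exp h0]
    exact hR.le

lemma exists_norm_le_of_mem_growthClassOne {F : ℂ → ℂ} {a b : ℝ} (hb : 0 < b)
    (h : F ∈ growthClassOne a b) :
    ∃ β C : ℝ, 0 < β ∧ β < b ∧ 0 < C ∧ ∀ z, ‖F z‖ ≤ C * Real.exp (β * ‖z‖ ^ a) := by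
  obtain ⟨hF, h | ⟨-, h⟩⟩ := h
  · obtain ⟨C, hC, hle⟩ := exists_norm_le_of_eventually_maxModulus_le hF.continuous (half_pos hb)
      (eventually_le_of_growthOrder_lt (half_pos hb) h)
    exact ⟨b / 2, C, half_pos hb, half_lt_self hb, hC, hle⟩
  · obtain ⟨s, hs1, hs2⟩ := EReal.lt_iff_exists_real_btwn.1 h
    have hsb : s < b := EReal.coe_lt_coe_iff.1 hs2
    -- The maximum with `b / 2` keeps the rate positive while staying below `b`.
    have hβ : 0 < max s (b / 2) := lt_max_of_lt_right (half_pos hb)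
    have hlt : growthType F a < ((max s (b / 2) : ℝ) : EReal) :=
      hs1.trans_le (EReal.coe_le_coe_iff.2 (le_max_left _ _))
    obtain ⟨C, hC, hle⟩ := exists_norm_le_of_eventually_maxModulus_le hF.continuous hβ
      (eventually_le_of_growthType_lt hlt)
    exact ⟨_, C, hβ, max_lt hsb (half_lt_self hb), hC, hle⟩

lemma eventually_log_maxModulus_le {F : ℂ → ℂ} {a β β' C : ℝ} (ha : 0 < a) (hC : 0 < C)
    (hβ : 0 ≤ β) (hlt : β < β') (h : ∀ z, ‖F z‖ ≤ C * Real.exp (β * ‖z‖ ^ a)) :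
    ∀ᶠ R in atTop, Real.log (maxModulus F R) ≤ β' * R ^ a := by
  have hlim : Tendsto (fun R : ℝ => (β' - β) * R ^ a) atTop atTop :=
    (tendsto_rpow_atTop ha).const_mul_atTop (by linarith)
  filter_upwards [hlim.eventually (eventually_ge_atTop (Real.log C)), eventually_gt_atTop 0]
    with R hR hR0
  have hM := maxModulus_le hR0.le fun z hz => by simpa [hz] using h z
  have hRa := Real.rpow_pos_of_pos hR0 a
  rcases (maxModulus_nonneg F R).eq_or_lt with h0 | h0
  · rw [← h0, Real.log_zero]
    exact mul_nonneg (hβ.trans hlt.le) hRa.le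
  · have := Real.log_le_log h0 hM
    rw [Real.log_mul hC.ne' (Real.exp_pos _).ne', Real.log_exp] at this
    linarith

lemma growthType_le_of_norm_le {F : ℂ → ℂ} {a b : ℝ} (ha : 0 < a) (hb : 0 ≤ b)
    (h : ∀ β, b < β → ∃ C : ℝ, 0 < C ∧ ∀ z, ‖F z‖ ≤ C * Real.exp (β * ‖z‖ ^ a)) :
    growthType F a ≤ (b : EReal) := by
  rw [← EReal.le_of_forall_lt_iff_le]
  intro β hβ
  obtain ⟨β₁, h1, h2⟩ := exists_between (EReal.coe_lt_coe_iff.1 hβ)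
  obtain ⟨C, hC, hle⟩ := h β₁ h1
  refine limsup_le_of_le (by isBoundedDefault) ?_
  filter_upwards [eventually_log_maxModulus_le ha hC (hb.trans h1.le) h2 hle,
    eventually_gt_atTop 0] with R hR hR0
  rw [EReal.coe_le_coe_iff, div_le_iff₀ (Real.rpow_pos_of_pos hR0 a)]
  exact hR

/-- The numerator is a fixed real number, whatever convention `Real.log` follows there, so this
covers `w = 0` too. -/
lemma growthOrder_const (w : ℂ) : growthOrder (fun _ => w) = 0 := by
  have h1 : Tendsto (fun R : ℝ => Real.log (Real.log ‖w‖) / Real.log R) atTop (𝓝 0) :=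
    Real.tendsto_log_atTop.const_div_atTop _
  have h2 : Tendsto (fun R : ℝ => ((Real.log (Real.log (maxModulus (fun _ => w) R)) /
      Real.log R : ℝ) : EReal)) atTop (𝓝 ((0 : ℝ) : EReal)) := by
    refine (continuous_coe_real_ereal.tendsto 0).comp (h1.congr' ?_)
    filter_upwards [eventually_ge_atTop 0] with R hR
    rw [maxModulus, Set.Nonempty.image_const (NormedSpace.sphere_nonempty.2 hR), csSup_singleton]
  exact h2.limsup_eq

/-- Taking a second logarithm needs `log M(R) > 0`. If some `c n ≠ 0` with `n > 0`, Cauchy's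
estimate gives `M(R) ≥ ‖c n‖ R ^ n → ∞`; constants are treated apart. -/
lemma growthOrder_le_of_norm_le {F : ℂ → ℂ} (hF : Differentiable ℂ F) {a β C : ℝ} (ha : 0 < a)
    (hβ : 0 < β) (hC : 0 < C) (h : ∀ z, ‖F z‖ ≤ C * Real.exp (β * ‖z‖ ^ a)) :
    growthOrder F ≤ (a : EReal) := by
  obtain ⟨c, hc⟩ := exists_hasSum_of_differentiable hF
  by_cases hconst : ∀ n, 0 < n → c n = 0
  · have : F = fun _ => c 0 := by
      funext z
      refine (hc z).unique ?_
      convert hasSum_single (f := fun n => c n * z ^ n) 0 ?_ using 1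
      · simp
      · intro n hn
        simp [hconst n (Nat.pos_of_ne_zero hn)]
    rw [this, growthOrder_const]
    exact_mod_cast ha.le
  push Not at hconst
  obtain ⟨n, hn, hcn⟩ := hconst
  rw [← EReal.le_of_forall_lt_iff_le]
  intro r hr
  have har : a < r := EReal.coe_lt_coe_iff.1 hr
  refine limsup_le_of_le (by isBoundedDefault) ?_
  have hlow : Tendsto (fun R : ℝ => ‖c n‖ * R ^ n) atTop atTop :=
    (tendsto_pow_atTop hn.ne').const_mul_atTop (norm_pos_iff.2 hcn)
  have hlog : Tendsto (fun R : ℝ => (r - a) * Real.log R) atTop atTop :=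
    Real.tendsto_log_atTop.const_mul_atTop (by linarith)
  filter_upwards [eventually_log_maxModulus_le ha hC hβ.le (lt_add_one β) h,
    hlow.eventually (eventually_gt_atTop 1), hlog.eventually (eventually_ge_atTop
      (Real.log (β + 1))), eventually_gt_atTop 1] with R hR hR1 hR2 hR3
  have hR0 : 0 < R := by linarith
  have hl : 0 < Real.log R := Real.log_pos hR3
  have hM : 1 < maxModulus F R := hR1.trans_le (norm_coeff_le_of_norm_le hc n hR0 fun z hz => by
    rw [← hz]
    exact norm_le_maxModulus hF.continuous z)
  have hM' : 0 < Real.log (maxModulus F R) := Real.log_pos hM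
  have := Real.log_le_log hM' hR
  rw [Real.log_mul (by linarith) (Real.rpow_pos_of_pos hR0 a).ne', Real.log_rpow hR0] at this
  rw [EReal.coe_le_coe_iff, div_le_iff₀ hl]
  linarith

lemma mem_growthClass_of_norm_le {F : ℂ → ℂ} (hF : Differentiable ℂ F) {a b : ℝ} (ha : 0 < a)
    (hb : 0 < b) (h : ∀ β, b < β → ∃ C : ℝ, 0 < C ∧ ∀ z, ‖F z‖ ≤ C * Real.exp (β * ‖z‖ ^ a)) :
    F ∈ growthClass a b := by
  obtain ⟨C, hC, hle⟩ := h (b + 1) (by linarith)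
  rcases (growthOrder_le_of_norm_le hF ha (by linarith) hC hle).lt_or_eq with h1 | h1
  · exact ⟨hF, Or.inl h1⟩
  · exact ⟨hF, Or.inr ⟨h1, growthType_le_of_norm_le ha hb.le h⟩⟩

/-! ### Membership in the Bargmann space and growth -/

section Weighted

variable {ρ : ℕ → ℝ} {W : ℝ → ℝ} {a b : ℝ}

/-- The lower moment bound at `b₁` gives `‖c n‖ ≲ (n + 1) / kappa a b₁ n`. Passing from `b₁` to `b₂`
absorbs `n + 1`, and passing from `b₂` to `β` sums the series. -/
lemma exists_norm_tsum_le_of_moment_bound (hρ : ∀ n, 0 < ρ n) (hW : IsWeight ρ W)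
    (ha : 0 < a) (hb : 0 < b)
    (h : LogAsymptotic (fun R : ℝ => W (R ^ 2)) (fun R : ℝ => Real.exp (-2 * b * R ^ a)))
    {c : ℕ → ℂ} {K : ℝ} (hK : ∀ n : ℕ, ‖c n‖ ^ 2 * ρ n ≤ K * ((n : ℝ) + 1) ^ 2)
    {β : ℝ} (hβ : b < β) :
    ∃ C : ℝ, 0 < C ∧ ∀ z : ℂ, Summable (fun n => c n * z ^ n) ∧
      ‖∑' n, c n * z ^ n‖ ≤ C * Real.exp (β * ‖z‖ ^ a) := by
  obtain ⟨b₂, h2, h2β⟩ := exists_between hβ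
  obtain ⟨b₁, h1, h12⟩ := exists_between h2
  have hb₁ := hb.trans h1
  obtain ⟨d, hd, hlow⟩ := exists_le_moment hρ hW ha hb h h1
  obtain ⟨q, q0, q1, hq⟩ := exists_kappa_ratio ha hb₁ h12
  obtain ⟨P, hP, hpoly⟩ := exists_poly_mul_geom_le 1 q0 q1
  have hK0 : 0 ≤ K := by
    have h0 := hK 0
    have : 0 ≤ ‖c 0‖ ^ 2 * ρ 0 := mul_nonneg (sq_nonneg _) (hρ 0).le
    norm_num at h0
    linarith
  refine summable_of_le_kappa ha (hb₁.trans h12) (C := Real.sqrt (K / d) * P) (fun n => ?_) h2β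
  have hk := kappa_pos a b₁ n
  have h3 : (‖c n‖ * kappa a b₁ n) ^ 2 ≤ (Real.sqrt (K / d) * ((n : ℝ) + 1)) ^ 2 := by
    rw [mul_pow, mul_pow, Real.sq_sqrt (by positivity), div_mul_eq_mul_div, le_div_iff₀ hd]
    calc ‖c n‖ ^ 2 * kappa a b₁ n ^ 2 * d = ‖c n‖ ^ 2 * (d * kappa a b₁ n ^ 2) := by ring
      _ ≤ ‖c n‖ ^ 2 * ρ n := by gcongr; exact hlow n
      _ ≤ _ := hK n
  have h4 := le_of_sq_le_sq h3 (by positivity)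
  rw [le_div_iff₀ (kappa_pos _ _ _), hq n]
  have h5 := hpoly n
  rw [pow_one] at h5
  calc ‖c n‖ * (kappa a b₁ n * q ^ n) = ‖c n‖ * kappa a b₁ n * q ^ n := by ring
    _ ≤ Real.sqrt (K / d) * ((n : ℝ) + 1) * q ^ n := by gcongr
    _ = Real.sqrt (K / d) * (((n : ℝ) + 1) * q ^ n) := by ring
    _ ≤ _ := by gcongr

/-- Cauchy's estimate at `β` and the moment bound at `b₁ > β` leave `q ^ (2 n)`: one `q ^ n` absorbs
the polynomial, the other is summed. -/
lemma summable_pow_mul_coeff_of_norm_le (hρ : ∀ n, 0 < ρ n) (hW : IsWeight ρ W)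
    (ha : 0 < a) (hb : 0 < b)
    (h : LogAsymptotic (fun R : ℝ => W (R ^ 2)) (fun R : ℝ => Real.exp (-2 * b * R ^ a)))
    {F : ℂ → ℂ} {c : ℕ → ℂ} (hc : ∀ z, HasSum (fun n => c n * z ^ n) (F z))
    {β C : ℝ} (hβ : 0 < β) (hlt : β < b) (hF : ∀ z, ‖F z‖ ≤ C * Real.exp (β * ‖z‖ ^ a)) (k : ℕ) :
    Summable fun n : ℕ => ((n : ℝ) + 1) ^ k * ‖c n‖ ^ 2 * ρ n := by
  obtain ⟨b₁, h1, h1b⟩ := exists_between hlt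
  obtain ⟨D, hD, hup⟩ := exists_moment_le hW ha hb (hβ.trans h1) h h1b
  obtain ⟨q, q0, q1, hq⟩ := exists_kappa_ratio ha hβ h1
  obtain ⟨P, hP, hpoly⟩ := exists_poly_mul_geom_le k q0 q1
  have hcn := norm_coeff_le_kappa hc ha hβ hF
  have hg := (summable_geometric_of_lt_one q0.le q1).mul_left (C ^ 2 * D * P)
  refine Summable.of_nonneg_of_le (fun n => ?_) (fun n => ?_) hg
  · have := hρ n
    positivity
  · have hk := kappa_pos a β n
    have h2 : ‖c n‖ * kappa a β n ≤ C := (le_div_iff₀ hk).1 (hcn n)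
    have h3 : (‖c n‖ * kappa a β n) ^ 2 ≤ C ^ 2 := pow_le_pow_left₀ (by positivity) h2 2
    calc ((n : ℝ) + 1) ^ k * ‖c n‖ ^ 2 * ρ n
        ≤ ((n : ℝ) + 1) ^ k * ‖c n‖ ^ 2 * (D * kappa a b₁ n ^ 2) := by
          gcongr
          exact hup n
      _ = (‖c n‖ * kappa a β n) ^ 2 * D * (((n : ℝ) + 1) ^ k * q ^ n) * q ^ n := by
          rw [hq n]; ring
      _ ≤ C ^ 2 * D * P * q ^ n := by
          have := hpoly n
          gcongr

lemma growthClassOne_subset_bargmannSpace (hρ : ∀ n, 0 < ρ n) (hW : IsWeight ρ W)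
    (ha : 0 < a) (hb : 0 < b)
    (h : LogAsymptotic (fun R : ℝ => W (R ^ 2)) (fun R : ℝ => Real.exp (-2 * b * R ^ a))) :
    growthClassOne a b ⊆ bargmannSpace W := by
  intro F hF
  obtain ⟨β, C, hβ, hβb, -, hle⟩ := exists_norm_le_of_mem_growthClassOne hb hF
  obtain ⟨c, hc⟩ := exists_hasSum_of_differentiable hF.1
  exact ⟨hF.1, bargmannNormSq_lt_top hW hc
    (summable_pow_mul_coeff_of_norm_le hρ hW ha hb h hc hβ hβb hle 2)⟩

lemma mem_growthClass_of_moment_bound (hρ : ∀ n, 0 < ρ n) (hW : IsWeight ρ W)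
    (ha : 0 < a) (hb : 0 < b)
    (h : LogAsymptotic (fun R : ℝ => W (R ^ 2)) (fun R : ℝ => Real.exp (-2 * b * R ^ a)))
    {F : ℂ → ℂ} {c : ℕ → ℂ} (hc : ∀ z, HasSum (fun n => c n * z ^ n) (F z))
    {K : ℝ} (hK : ∀ n : ℕ, ‖c n‖ ^ 2 * ρ n ≤ K * ((n : ℝ) + 1) ^ 2) :
    F ∈ growthClass a b := by
  refine mem_growthClass_of_norm_le (differentiable_of_hasSum hc) ha hb fun β hβ => ?_
  obtain ⟨C, hC, hle⟩ := exists_norm_tsum_le_of_moment_bound hρ hW ha hb h hK hβ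
  refine ⟨C, hC, fun z => ?_⟩
  rw [← (hc z).tsum_eq]
  exact (hle z).2

lemma norm_coeff_sq_mul_le_toReal (hW : IsWeight ρ W)
    {F : ℂ → ℂ} (hF : F ∈ bargmannSpace W)
    {c : ℕ → ℂ} (hc : ∀ z, HasSum (fun n => c n * z ^ n) (F z)) (n : ℕ) :
    ‖c n‖ ^ 2 * ρ n ≤ (bargmannNormSq W F).toReal := by
  have := norm_coeff_sq_mul_le_bargmannNormSq hW hc n
  rwa [ENNReal.ofReal_le_iff_le_toReal hF.2.ne] at this

lemma bargmannSpace_subset_growthClass (hρ : ∀ n, 0 < ρ n) (hW : IsWeight ρ W)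
    (ha : 0 < a) (hb : 0 < b)
    (h : LogAsymptotic (fun R : ℝ => W (R ^ 2)) (fun R : ℝ => Real.exp (-2 * b * R ^ a))) :
    bargmannSpace W ⊆ growthClass a b := by
  intro F hF
  obtain ⟨c, hc⟩ := exists_hasSum_of_differentiable hF.1
  refine mem_growthClass_of_moment_bound hρ hW ha hb h hc
    (K := (bargmannNormSq W F).toReal) fun n => ?_
  refine (norm_coeff_sq_mul_le_toReal hW hF hc n).trans (le_mul_of_one_le_right
    ENNReal.toReal_nonneg ?_)
  exact one_le_pow₀ (by linarith [(Nat.cast_nonneg n : (0 : ℝ) ≤ n)])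

/-- A power series whose weighted coefficients neither grow fast nor decay fast
has order `a` and type `b`. -/
lemma exists_hasSum_mem_diff (hρ : ∀ n, 0 < ρ n) (hW : IsWeight ρ W)
    (ha : 0 < a) (hb : 0 < b)
    (h : LogAsymptotic (fun R : ℝ => W (R ^ 2)) (fun R : ℝ => Real.exp (-2 * b * R ^ a)))
    {c : ℕ → ℂ} (hup : ∀ n : ℕ, ‖c n‖ ^ 2 * ρ n ≤ 1 * ((n : ℝ) + 1) ^ 2)
    (hlow : ∀ n : ℕ, 1 ≤ ((n : ℝ) + 1) ^ 4 * ‖c n‖ ^ 2 * ρ n) :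
    ∃ F : ℂ → ℂ, (∀ z, HasSum (fun n => c n * z ^ n) (F z)) ∧
      F ∈ growthClass a b \ growthClassOne a b := by
  obtain ⟨C, -, hC⟩ := exists_norm_tsum_le_of_moment_bound hρ hW ha hb h hup (lt_add_one b)
  have hc : ∀ z, HasSum (fun n => c n * z ^ n) (∑' n, c n * z ^ n) := fun z => (hC z).1.hasSum
  refine ⟨fun z => ∑' n, c n * z ^ n, hc,
    mem_growthClass_of_moment_bound hρ hW ha hb h hc hup, fun hmem => ?_⟩
  obtain ⟨β, C, hβ, hβb, -, hle⟩ := exists_norm_le_of_mem_growthClassOne hb hmem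
  -- Growth at a rate below `b` would make these terms tend to 0, yet `hlow` keeps them at least 1.
  have hs := summable_pow_mul_coeff_of_norm_le hρ hW ha hb h hc hβ hβb hle 4
  have := ge_of_tendsto' hs.tendsto_atTop_zero hlow
  norm_num at this

lemma exists_mem_diff_mem_bargmannSpace (hρ : ∀ n, 0 < ρ n) (hW : IsWeight ρ W)
    (ha : 0 < a) (hb : 0 < b)
    (h : LogAsymptotic (fun R : ℝ => W (R ^ 2)) (fun R : ℝ => Real.exp (-2 * b * R ^ a))) :
    ∃ F : ℂ → ℂ, F ∈ growthClass a b \ growthClassOne a b ∧ F ∈ bargmannSpace W := by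
  -- Here `‖c n‖ ^ 2 * ρ n = (n + 1) ^ (-4)`: summable against `(n + 1) ^ 2`, not against `(n + 1) ^
  -- 4`.
  let c : ℕ → ℂ := fun n => (((((n : ℝ) + 1) ^ 2 * Real.sqrt (ρ n))⁻¹ : ℝ) : ℂ)
  have hval : ∀ n, ‖c n‖ ^ 2 * ρ n = ((((n : ℝ) + 1) ^ 4)⁻¹ : ℝ) := fun n => by
    have := hρ n
    simp only [c, Complex.norm_real, Real.norm_eq_abs, sq_abs]
    rw [inv_pow, mul_pow, Real.sq_sqrt this.le]
    field_simp
  have hone : ∀ n : ℕ, (1 : ℝ) ≤ (n : ℝ) + 1 := fun n => by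
    linarith [(Nat.cast_nonneg n : (0 : ℝ) ≤ n)]
  obtain ⟨F, hF, hmem⟩ := exists_hasSum_mem_diff hρ hW ha hb h (c := c)
    (fun n => by
      rw [hval, one_mul]
      exact (inv_le_one_of_one_le₀ (one_le_pow₀ (hone n))).trans (one_le_pow₀ (hone n)))
    (fun n => by
      rw [mul_assoc, hval, mul_inv_cancel₀ (by positivity)])
  refine ⟨F, hmem, hmem.1.1, bargmannNormSq_lt_top hW hF ?_⟩
  have hS := (summable_nat_add_iff 1).2 (Real.summable_nat_pow_inv (p := 2).2 one_lt_two)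
  refine hS.congr fun n => ?_
  rw [mul_assoc, hval]
  push_cast
  field_simp

lemma exists_mem_diff_notMem_bargmannSpace (hρ : ∀ n, 0 < ρ n) (hW : IsWeight ρ W)
    (ha : 0 < a) (hb : 0 < b)
    (h : LogAsymptotic (fun R : ℝ => W (R ^ 2)) (fun R : ℝ => Real.exp (-2 * b * R ^ a))) :
    ∃ F : ℂ → ℂ, F ∈ growthClass a b \ growthClassOne a b ∧ F ∉ bargmannSpace W := by
  -- Here `‖c n‖ ^ 2 * ρ n = (n + 1) ^ 2` is unbounded, whereas a finite Bargmann norm would bound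
  -- it.
  let c : ℕ → ℂ := fun n => ((((n : ℝ) + 1) / Real.sqrt (ρ n) : ℝ) : ℂ)
  have hval : ∀ n, ‖c n‖ ^ 2 * ρ n = ((n : ℝ) + 1) ^ 2 := fun n => by
    have := hρ n
    simp only [c, Complex.norm_real, Real.norm_eq_abs, sq_abs]
    rw [div_pow, Real.sq_sqrt this.le]
    field_simp
  have hone : ∀ n : ℕ, (1 : ℝ) ≤ (n : ℝ) + 1 := fun n => by
    linarith [(Nat.cast_nonneg n : (0 : ℝ) ≤ n)]
  obtain ⟨F, hF, hmem⟩ := exists_hasSum_mem_diff hρ hW ha hb h (c := c)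
    (fun n => by rw [hval, one_mul])
    (fun n => by
      rw [mul_assoc, hval]
      exact one_le_mul_of_one_le_of_one_le (one_le_pow₀ (hone n)) (one_le_pow₀ (hone n)))
  refine ⟨F, hmem, fun hB => ?_⟩
  obtain ⟨n, hn⟩ := exists_nat_gt (bargmannNormSq W F).toReal
  have := norm_coeff_sq_mul_le_toReal hW hB hF n
  rw [hval] at this
  nlinarith [hone n]

end Weighted

/-! ### Coherent states -/

section States

variable {H : Type*} [NormedAddCommGroup H] [InnerProductSpace ℂ H]

lemma hasSum_coherentState (e : HilbertBasis ℕ ℂ H) {ρ : ℕ → ℝ} (hρ : IsAdmissible ρ) (z : ℂ) :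
    HasSum (fun n : ℕ => (z ^ n / ((Real.sqrt (ρ n) : ℝ) : ℂ)) • e n)
      (∑' n : ℕ, (z ^ n / ((Real.sqrt (ρ n) : ℝ) : ℂ)) • e n) := by
  have hmem : Memℓp (fun n : ℕ => z ^ n / ((Real.sqrt (ρ n) : ℝ) : ℂ)) 2 := by
    apply memℓp_gen
    refine (hρ.summable z).congr fun n => ?_
    rw [norm_div, norm_pow, Complex.norm_real, Real.norm_eq_abs, abs_of_nonneg (Real.sqrt_nonneg _)]
    norm_num
    rw [div_pow, Real.sq_sqrt (hρ.pos n).le, ← pow_mul, mul_comm n 2]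
  exact (e.hasSum_repr_symm ⟨_, hmem⟩).summable.hasSum

lemma normalization_pos {ρ : ℕ → ℝ} (hρ : IsAdmissible ρ) (z : ℂ) :
    0 < normalization ρ (‖z‖ ^ 2) := by
  have hs : Summable fun n : ℕ => (‖z‖ ^ 2) ^ n / ρ n := by
    simpa only [← pow_mul] using hρ.summable z
  refine hs.tsum_pos (fun n => ?_) 0 ?_
  · have := hρ.pos n
    positivity
  · simp [hρ.zero_eq_one]

lemma inner_coherentState (e : HilbertBasis ℕ ℂ H) {ρ : ℕ → ℝ} (hρ : IsAdmissible ρ) (z : ℂ)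
    (s : H) : inner ℂ s (coherentState e ρ z) =
      (((Real.sqrt (normalization ρ (‖z‖ ^ 2)))⁻¹ : ℝ) : ℂ) *
        ∑' n, (inner ℂ s (e n) / ((Real.sqrt (ρ n) : ℝ) : ℂ)) * z ^ n := by
  have h := (hasSum_coherentState e hρ z).mapL (innerSL ℂ s)
  rw [coherentState, inner_smul_right]
  congr 1
  have h2 := h.tsum_eq
  simp only [innerSL_apply_apply, inner_smul_right] at h2
  rw [← h2]
  refine tsum_congr fun n => ?_
  ring

lemma inner_coherentState_eq_zero_iff (e : HilbertBasis ℕ ℂ H) {ρ : ℕ → ℝ} (hρ : IsAdmissible ρ)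
    (z : ℂ) (s : H) : inner ℂ (coherentState e ρ z) s = 0 ↔
      ∑' n, (inner ℂ s (e n) / ((Real.sqrt (ρ n) : ℝ) : ℂ)) * z ^ n = 0 := by
  rw [inner_eq_zero_symm, inner_coherentState e hρ]
  have := normalization_pos hρ z
  have h2 : (((Real.sqrt (normalization ρ (‖z‖ ^ 2)))⁻¹ : ℝ) : ℂ) ≠ 0 := by
    exact_mod_cast (inv_pos.2 (Real.sqrt_pos.2 this)).ne'
  rw [mul_eq_zero, or_iff_right h2]

/-- The component along `e 0` determines the normalization, and then that along `e 1` determines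
`z`. Hence removing one state from the set removes just one index. -/
lemma coherentState_injective (e : HilbertBasis ℕ ℂ H) {ρ : ℕ → ℝ} (hρ : IsAdmissible ρ) :
    Function.Injective (coherentState e ρ) := by
  have hval : ∀ (k : ℕ) (z : ℂ), inner ℂ (e k) (coherentState e ρ z) =
      (((Real.sqrt (normalization ρ (‖z‖ ^ 2)))⁻¹ : ℝ) : ℂ) *
        (z ^ k / ((Real.sqrt (ρ k) : ℝ) : ℂ)) := by
    intro k z
    rw [inner_coherentState e hρ, tsum_eq_single k]
    · rw [orthonormal_iff_ite.1 e.orthonormal, if_pos rfl]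
      ring
    · intro n hn
      rw [orthonormal_iff_ite.1 e.orthonormal, if_neg hn.symm, zero_div, zero_mul]
  intro z w hzw
  have h0 := hval 0 z
  have h1 := hval 1 z
  rw [hzw, hval 0 w] at h0
  rw [hzw, hval 1 w] at h1
  have hw : (((Real.sqrt (normalization ρ (‖w‖ ^ 2)))⁻¹ : ℝ) : ℂ) ≠ 0 := by
    exact_mod_cast (inv_pos.2 (Real.sqrt_pos.2 (normalization_pos hρ w))).ne'
  have hr : ((Real.sqrt (ρ 1) : ℝ) : ℂ) ≠ 0 := by
    exact_mod_cast (Real.sqrt_pos.2 (hρ.pos 1)).ne'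
  simp only [pow_zero, hρ.zero_eq_one, Real.sqrt_one, Complex.ofReal_one, div_one, mul_one] at h0
  rw [← h0, pow_one, pow_one] at h1
  exact ((div_left_inj' hr).1 (mul_left_cancel₀ hw h1)).symm

end States

/-! ### Zeros of entire functions: upper bounds from Jensen's formula -/

/-- Jensen's formula, with zeros outside `T` and multiplicities dropped. The constant is minus the
log-modulus of the leading Taylor coefficient at 0, independent of `R`. -/
lemma exists_sum_log_le_of_zeros {F : ℂ → ℂ} (hF : Differentiable ℂ F) (hne : ∃ w, F w ≠ 0) :
    ∃ C : ℝ, ∀ (R M : ℝ) (T : Finset ℂ), 1 ≤ R → 0 ≤ M →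
      (∀ u ∈ T, F u = 0 ∧ ‖u‖ ≤ R) → (∀ z : ℂ, ‖z‖ = R → ‖F z‖ ≤ Real.exp M) →
      ∑ u ∈ T, Real.log (R * ‖u‖⁻¹) ≤ M + C := by
  refine ⟨-Real.log ‖meromorphicTrailingCoeffAt F 0‖, fun R M T hR hM hT hle => ?_⟩
  have hR0 : 0 < R := by linarith
  have han : AnalyticOnNhd ℂ F (Metric.closedBall 0 |R|) := fun z _ => hF.analyticAt z
  have hord : ∀ u, analyticOrderAt F u ≠ ⊤ := by
    intro u hu
    obtain ⟨w, hw⟩ := hne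
    rw [analyticOrderAt_eq_top] at hu
    exact hw ((AnalyticOnNhd.eqOn_zero_of_preconnected_of_eventuallyEq_zero
      (fun z _ => hF.analyticAt z) isPreconnected_univ (Set.mem_univ u) hu) (Set.mem_univ w))
  have hJ := han.meromorphicOn.circleAverage_log_norm hR0.ne'
  set D := MeromorphicOn.divisor F (Metric.closedBall 0 |R|) with hD
  have hDnn : ∀ u, 0 ≤ D u := MeromorphicOn.AnalyticOnNhd.divisor_nonneg han
  have havg : Real.circleAverage (fun z => Real.log ‖F z‖) 0 R ≤ M := by
    apply Real.circleAverage_mono_on_of_le_circle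
    · exact (han.mono Metric.sphere_subset_closedBall).meromorphicOn.circleIntegrable_log_norm
    · intro z hz
      -- At a zero on the circle `Real.log 0 = 0`, which is why `0 ≤ M` is required.
      rcases eq_zero_or_norm_pos (F z) with h | h
      · simpa [h] using hM
      · rw [Real.log_le_iff_le_exp h]
        exact hle z (by simpa [abs_of_pos hR0] using hz)
  have hterm : ∀ u : ℂ, 0 ≤ (D u : ℝ) * Real.log (R * ‖(0 : ℂ) - u‖⁻¹) := by
    intro u
    by_cases hu : u ∈ Metric.closedBall (0 : ℂ) |R|
    · refine mul_nonneg (by exact_mod_cast hDnn u) ?_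
      rcases eq_or_ne u 0 with rfl | hu0
      · simp
      · have : 0 < ‖u‖ := norm_pos_iff.2 hu0
        apply Real.log_nonneg
        rw [zero_sub, norm_neg, ← div_eq_mul_inv, one_le_div this]
        simpa [abs_of_pos hR0] using hu
    · simp [Function.locallyFinsuppWithin.apply_eq_zero_of_notMem _ hu]
  have hfinite : (Function.support fun u : ℂ =>
      (D u : ℝ) * Real.log (R * ‖(0 : ℂ) - u‖⁻¹)).Finite :=
    (D.finiteSupport (isCompact_closedBall _ _)).subset fun u hu => by
      simp only [Function.mem_support] at hu ⊢
      intro h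
      simp [h] at hu
  have hsum : ∑ u ∈ T, Real.log (R * ‖u‖⁻¹) ≤
      ∑ᶠ u : ℂ, (D u : ℝ) * Real.log (R * ‖(0 : ℂ) - u‖⁻¹) := by
    rw [finsum_eq_sum_of_support_subset (s := T ∪ hfinite.toFinset) _ (by
      intro u hu
      simp only [Finset.coe_union, Set.Finite.coe_toFinset]
      exact Or.inr hu)]
    refine le_trans (Finset.sum_le_sum fun u hu => ?_)
      (Finset.sum_le_sum_of_subset_of_nonneg Finset.subset_union_left fun u _ _ => hterm u)
    obtain ⟨hu0, huR⟩ := hT u hu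
    have humem : u ∈ Metric.closedBall (0 : ℂ) |R| := by simpa [abs_of_pos hR0] using huR
    have hD1 : (1 : ℝ) ≤ D u := by
      have : D u ≠ 0 := by
        rw [hD, MeromorphicOn.AnalyticOnNhd.divisor_apply han humem]
        have h1 : analyticOrderAt F u ≠ 0 := fun h =>
          ((hF.analyticAt u).analyticOrderAt_eq_zero.1 h) hu0
        lift analyticOrderAt F u to ℕ using hord u with k
        simpa using h1
      have := hDnn u
      exact_mod_cast (by omega : 1 ≤ D u)
    have hlog : 0 ≤ Real.log (R * ‖u‖⁻¹) := by
      rcases eq_or_ne u 0 with rfl | hu0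
      · simp
      · have : 0 < ‖u‖ := norm_pos_iff.2 hu0
        apply Real.log_nonneg
        rwa [← div_eq_mul_inv, one_le_div this]
    rw [zero_sub, norm_neg]
    exact le_mul_of_one_le_left hlog hD1
  have hzero : 0 ≤ (D 0 : ℝ) * Real.log R :=
    mul_nonneg (by exact_mod_cast hDnn 0) (Real.log_nonneg hR)
  linarith

/-! ### Counting the points of the sequence against Jensen's bound -/

lemma finite_norm_lt {z : ℕ → ℂ} (hz : Tendsto (fun N => ‖z N‖) atTop atTop) (R : ℝ) :
    {N : ℕ | ‖z N‖ < R}.Finite := by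
  obtain ⟨N₀, hN₀⟩ := eventually_atTop.1 (hz.eventually (eventually_ge_atTop R))
  refine (Set.finite_lt_nat N₀).subset fun N hN => ?_
  by_contra h
  exact absurd (hN₀ N (not_lt.1 h)) (not_le.2 hN)

/-- The indices `N ≠ 0` of the nonzero terms in the disc `|z| < R`. -/
noncomputable def innerIndices {z : ℕ → ℂ} (hz : Tendsto (fun N => ‖z N‖) atTop atTop) (R : ℝ) :
    Finset ℕ :=
  (finite_norm_lt hz R).toFinset.filter fun N => N ≠ 0 ∧ z N ≠ 0

lemma mem_innerIndices {z : ℕ → ℂ} {hz : Tendsto (fun N => ‖z N‖) atTop atTop} {R : ℝ} {N : ℕ} :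
    N ∈ innerIndices hz R ↔ ‖z N‖ < R ∧ N ≠ 0 ∧ z N ≠ 0 := by
  simp [innerIndices]

/-- The 2 accounts for the index 0, to be removed, and for at most one index with `z N = 0`. -/
lemma countingFunction_le_card {z : ℕ → ℂ} (hz : Tendsto (fun N => ‖z N‖) atTop atTop)
    (hinj : Function.Injective z) (R : ℝ) :
    (countingFunction z R : ℝ) ≤ (innerIndices hz R).card + 2 := by
  rw [countingFunction, Set.ncard_eq_toFinset_card _ (finite_norm_lt hz R)]
  have h1 := Finset.card_filter_add_card_filter_not (s := (finite_norm_lt hz R).toFinset)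
    (fun N => N ≠ 0 ∧ z N ≠ 0)
  have h2 : ((finite_norm_lt hz R).toFinset.filter fun N => ¬ (N ≠ 0 ∧ z N ≠ 0)).card ≤ 2 := by
    classical
    have hsub : ((finite_norm_lt hz R).toFinset.filter fun N => ¬ (N ≠ 0 ∧ z N ≠ 0)) ⊆
        {0} ∪ ((finite_norm_lt hz R).toFinset.filter fun N => z N = 0) := by
      intro N hN
      simp only [Finset.mem_filter, Finset.mem_union, Finset.mem_singleton] at hN ⊢
      tauto
    refine (Finset.card_le_card hsub).trans ((Finset.card_union_le _ _).trans ?_)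
    have : ((finite_norm_lt hz R).toFinset.filter fun N => z N = 0).card ≤ 1 := by
      rw [Finset.card_le_one]
      intro x hx y hy
      simp only [Finset.mem_filter] at hx hy
      exact hinj (hx.2.trans hy.2.symm)
    rw [Finset.card_singleton]
    omega
  rw [← h1]
  push_cast
  have h3 : ((((finite_norm_lt hz R).toFinset.filter fun N => ¬ (N ≠ 0 ∧ z N ≠ 0)).card : ℕ) : ℝ)
      ≤ 2 := by exact_mod_cast h2
  rw [innerIndices]
  linarith

lemma exists_sum_log_div_le {F : ℂ → ℂ} (hF : Differentiable ℂ F) (hne : ∃ w, F w ≠ 0)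
    {z : ℕ → ℂ} (hz : Tendsto (fun N => ‖z N‖) atTop atTop) (hinj : Function.Injective z)
    (hzero : ∀ N, N ≠ 0 → F (z N) = 0) {a β C : ℝ} (hβ : 0 < β) (hC : 0 < C)
    (hle : ∀ w, ‖F w‖ ≤ C * Real.exp (β * ‖w‖ ^ a)) :
    ∃ C' : ℝ, ∀ R, 1 ≤ R →
      ∑ N ∈ innerIndices hz R, Real.log (R / ‖z N‖) ≤ β * R ^ a + C' := by
  classical
  obtain ⟨C₁, hC₁⟩ := exists_sum_log_le_of_zeros hF hne
  refine ⟨|Real.log C| + C₁, fun R hR => ?_⟩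
  have hR0 : 0 < R := by linarith
  have h := hC₁ R (β * R ^ a + |Real.log C|) ((innerIndices hz R).image z) hR
    (by positivity) (by
      intro u hu
      obtain ⟨N, hN, rfl⟩ := Finset.mem_image.1 hu
      obtain ⟨h1, h2, -⟩ := mem_innerIndices.1 hN
      exact ⟨hzero N h2, h1.le⟩) (by
      intro w hw
      refine (hle w).trans ?_
      rw [hw, add_comm, Real.exp_add]
      gcongr
      rw [← Real.log_le_iff_le_exp hC]
      exact le_abs_self _)
  rw [Finset.sum_image hinj.injOn] at h
  simp only [← div_eq_mul_inv] at h
  linarith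

lemma integral_indicator_inv_le {s₀ R r : ℝ} (hs₀ : 0 < s₀) (hr : 0 < r) (hrR : r < R)
    (hs₀R : s₀ ≤ R) :
    ∫ s in Set.Ioc s₀ R, (Set.Ioi r).indicator (fun s => s⁻¹) s ≤ Real.log (R / r) := by
  have hm : 0 < max s₀ r := lt_max_of_lt_left hs₀
  rw [setIntegral_indicator measurableSet_Ioi, Set.Ioc_inter_Ioi,
    ← intervalIntegral.integral_of_le (max_le hs₀R hrR.le),
    integral_inv_of_pos hm (hr.trans hrR)]
  apply Real.log_le_log (div_pos (hr.trans hrR) hm)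
  have hR : 0 < R := hr.trans hrR
  gcongr
  exact le_max_right _ _

/-- Writing `log (R / ‖z N‖)` as an integral of `1 / s` turns the sum into the integral of the count
over `s`; restricting it to `s > s₀` only loses mass. The constant `d / a` is sharp. -/
lemma le_sum_log_of_count_ge {z : ℕ → ℂ} (hz : Tendsto (fun N => ‖z N‖) atTop atTop)
    {a d s₀ : ℝ} (ha : 0 < a) (hs₀ : 0 < s₀)
    (hcount : ∀ s, s₀ ≤ s → d * s ^ a ≤ (innerIndices hz s).card) {R : ℝ} (hR : s₀ ≤ R) :
    d / a * (R ^ a - s₀ ^ a) ≤ ∑ N ∈ innerIndices hz R, Real.log (R / ‖z N‖) := by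
  classical
  have hinv : IntegrableOn (fun s : ℝ => s⁻¹) (Set.Ioc s₀ R) := by
    refine ContinuousOn.integrableOn_Icc (fun s hs => ?_) |>.mono_set Set.Ioc_subset_Icc_self
    exact (continuousAt_inv₀ (hs₀.trans_le hs.1).ne').continuousWithinAt
  have hint : ∀ N, IntegrableOn ((Set.Ioi ‖z N‖).indicator fun s : ℝ => s⁻¹) (Set.Ioc s₀ R) :=
    fun N => hinv.indicator measurableSet_Ioi
  have hpow : IntegrableOn (fun s : ℝ => d * s ^ (a - 1)) (Set.Ioc s₀ R) := by
    refine ContinuousOn.integrableOn_Icc (fun s hs => ?_) |>.mono_set Set.Ioc_subset_Icc_self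
    exact ((Real.continuousAt_rpow_const s _ (Or.inl (hs₀.trans_le hs.1).ne')).const_mul
      d).continuousWithinAt
  calc d / a * (R ^ a - s₀ ^ a) = ∫ s in Set.Ioc s₀ R, d * s ^ (a - 1) := by
        rw [← intervalIntegral.integral_of_le hR, intervalIntegral.integral_const_mul,
          integral_rpow (Or.inl (by linarith)), sub_add_cancel]
        ring
    _ ≤ ∫ s in Set.Ioc s₀ R, ∑ N ∈ innerIndices hz R,
          (Set.Ioi ‖z N‖).indicator (fun s => s⁻¹) s := by
        refine setIntegral_mono_on hpow (integrable_finsetSum _ fun N _ => hint N)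
          measurableSet_Ioc fun s hs => ?_
        have hs0 : 0 < s := hs₀.trans hs.1
        have hsub : innerIndices hz s ⊆ innerIndices hz R := fun N hN => by
          rw [mem_innerIndices] at hN ⊢
          exact ⟨hN.1.trans_le hs.2, hN.2⟩
        have h1 : ∑ N ∈ innerIndices hz s, s⁻¹ ≤ ∑ N ∈ innerIndices hz R,
            (Set.Ioi ‖z N‖).indicator (fun s => s⁻¹) s := by
          refine le_trans (Finset.sum_le_sum fun N hN => ?_)
            (Finset.sum_le_sum_of_subset_of_nonneg hsub fun N _ _ =>
              Set.indicator_apply_nonneg fun _ => inv_nonneg.2 hs0.le)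
          rw [Set.indicator_of_mem]
          exact (mem_innerIndices.1 hN).1
        refine le_trans ?_ h1
        rw [Finset.sum_const, nsmul_eq_mul, Real.rpow_sub_one hs0.ne', mul_div_assoc',
          div_eq_mul_inv]
        exact mul_le_mul_of_nonneg_right (hcount s hs.1.le) (inv_nonneg.2 hs0.le)
    _ = ∑ N ∈ innerIndices hz R, ∫ s in Set.Ioc s₀ R,
          (Set.Ioi ‖z N‖).indicator (fun s => s⁻¹) s := integral_finsetSum _ fun N _ => hint N
    _ ≤ _ := by
        refine Finset.sum_le_sum fun N hN => ?_
        obtain ⟨h1, -, h3⟩ := mem_innerIndices.1 hN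
        exact integral_indicator_inv_le hs₀ (norm_pos_iff.2 h3) h1 hR

lemma card_mul_log_two_le_sum_log {z : ℕ → ℂ} (hz : Tendsto (fun N => ‖z N‖) atTop atTop)
    {R : ℝ} (hR : 0 < R) :
    (innerIndices hz R).card * Real.log 2 ≤
      ∑ N ∈ innerIndices hz (2 * R), Real.log (2 * R / ‖z N‖) := by
  have hsub : innerIndices hz R ⊆ innerIndices hz (2 * R) := fun N hN => by
    rw [mem_innerIndices] at hN ⊢
    exact ⟨by linarith [hN.1], hN.2⟩
  rw [← nsmul_eq_mul, ← Finset.sum_const]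
  refine le_trans (Finset.sum_le_sum fun N hN => ?_)
    (Finset.sum_le_sum_of_subset_of_nonneg hsub fun N hN _ => ?_)
  · obtain ⟨h1, -, h3⟩ := mem_innerIndices.1 hN
    have := norm_pos_iff.2 h3
    apply Real.log_le_log two_pos
    rw [le_div_iff₀ this]
    linarith
  · obtain ⟨h1, -, h3⟩ := mem_innerIndices.1 hN
    have := norm_pos_iff.2 h3
    apply Real.log_nonneg
    rw [one_le_div this]
    exact h1.le

/-- If `t > a`, the limsup gives many points only for some large `R`, and the crude count at radius
`2 R` suffices. If `t = a`, the sharp integral bound is needed: with `a b < d < δ` and `b < β < d /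
a`, it reads `(d / a) R ^ a ≤ β R ^ a + O(1)`, which is false for large `R`. -/
lemma eq_zero_of_zeros_of_density {F : ℂ → ℂ} (hF : Differentiable ℂ F)
    {a b : ℝ} (ha : 0 < a) (hb : 0 < b)
    (hle : ∀ β, b < β → ∃ C : ℝ, 0 < C ∧ ∀ z, ‖F z‖ ≤ C * Real.exp (β * ‖z‖ ^ a))
    {z : ℕ → ℂ} {t : ℝ} {δ : EReal} (hd : HasDensity z t δ) (hinj : Function.Injective z)
    (hlt : DensityLT (a, ((b * a : ℝ) : EReal)) (t, δ)) (hzero : ∀ N, N ≠ 0 → F (z N) = 0) :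
    ∀ w, F w = 0 := by
  by_contra hne
  push Not at hne
  have hz := hd.tendsto_norm
  have hcard := countingFunction_le_card hz hinj
  rcases hlt with hlt | ⟨hat, hlt⟩
  · change a < t at hlt
    obtain ⟨C, hC, hbound⟩ := hle (b + 1) (by linarith)
    obtain ⟨C', hC'⟩ := exists_sum_log_div_le hF hne hz hinj hzero (by linarith) hC hbound
    obtain ⟨t', h1, h2⟩ := exists_between hlt
    have hfreq : ∃ᶠ R : ℝ in atTop, (t' : EReal) <
        ((Real.log (countingFunction z R : ℝ) / Real.log R : ℝ) : EReal) := by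
      refine frequently_lt_of_lt_limsup (by isBoundedDefault) ?_
      rw [hd.limsup_eq]
      exact_mod_cast h2
    have hlog2 : 0 < Real.log 2 := Real.log_pos one_lt_two
    have hcoef : 0 < (b + 1) * 2 ^ a / Real.log 2 + 1 := by positivity
    have hgrow : Tendsto (fun R : ℝ => R ^ (t' - a)) atTop atTop :=
      tendsto_rpow_atTop (by linarith)
    have hgrow2 := tendsto_rpow_atTop ha
    have hev := hgrow.eventually (eventually_gt_atTop ((b + 1) * 2 ^ a / Real.log 2 + 1))
    have hev2 := hgrow2.eventually (eventually_gt_atTop (C' / Real.log 2 + 2))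
    obtain ⟨R, hR, hR1, hR2, hR3⟩ :=
      (hfreq.and_eventually (hev.and (hev2.and (eventually_gt_atTop 1)))).exists
    have hR0 : 0 < R := by linarith
    rw [EReal.coe_lt_coe_iff, lt_div_iff₀ (Real.log_pos hR3)] at hR
    have hn : R ^ t' < countingFunction z R := by
      have hpos : (0 : ℝ) < countingFunction z R := by
        rcases Nat.eq_zero_or_pos (countingFunction z R) with h0 | h0
        · rw [h0, Nat.cast_zero, Real.log_zero] at hR
          nlinarith [Real.log_pos hR3]
        · exact_mod_cast h0
      rw [← Real.log_rpow hR0] at hR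
      exact (Real.log_lt_log_iff (Real.rpow_pos_of_pos hR0 _) hpos).1 hR
    have h3 := hcard R
    have h4 := (card_mul_log_two_le_sum_log hz hR0).trans (hC' (2 * R) (by linarith))
    rw [Real.mul_rpow zero_le_two hR0.le, ← le_div_iff₀ hlog2, add_div] at h4
    have h5 : R ^ t' = R ^ (t' - a) * R ^ a := by
      rw [← Real.rpow_add hR0, sub_add_cancel]
    have hRa := Real.rpow_pos_of_pos hR0 a
    have h6 := mul_lt_mul_of_pos_right hR1 hRa
    have h7 : (b + 1) * (2 ^ a * R ^ a) / Real.log 2 = (b + 1) * 2 ^ a / Real.log 2 * R ^ a := by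
      ring
    rw [h7] at h4
    linarith
  · change a = t at hat
    change ((b * a : ℝ) : EReal) < δ at hlt
    subst hat
    obtain ⟨d', hd1, hd2⟩ := EReal.lt_iff_exists_real_btwn.1 hlt
    obtain ⟨d, h1, h2⟩ := exists_between (EReal.coe_lt_coe_iff.1 hd1)
    obtain ⟨β, hβ1, hβ2⟩ := exists_between ((lt_div_iff₀ ha).2 h1)
    obtain ⟨C, hC, hbound⟩ := hle β hβ1
    obtain ⟨C', hC'⟩ := exists_sum_log_div_le hF hne hz hinj hzero (hb.trans hβ1) hC hbound
    have hgrow := tendsto_rpow_atTop ha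
    have hev : ∀ᶠ s : ℝ in atTop, d * s ^ a ≤ (innerIndices hz s).card := by
      have hlim : Tendsto (fun s : ℝ => (d' - d) * s ^ a) atTop atTop :=
        hgrow.const_mul_atTop (by linarith)
      filter_upwards [hd.tendsto_ratio.eventually (lt_mem_nhds hd2),
        hlim.eventually (eventually_ge_atTop 2), eventually_gt_atTop 0] with s hs hs2 hs0
      rw [EReal.coe_lt_coe_iff, lt_div_iff₀ (Real.rpow_pos_of_pos hs0 a)] at hs
      have := hcard s
      linarith
    obtain ⟨s₀, hs₀⟩ := eventually_atTop.1 (hev.and (eventually_gt_atTop 0))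
    have hlow := fun R (hR : s₀ ≤ R) =>
      le_sum_log_of_count_ge hz ha (hs₀ s₀ le_rfl).2 (fun s hs => (hs₀ s hs).1) hR
    have hlim : Tendsto (fun s : ℝ => (d / a - β) * s ^ a) atTop atTop :=
      hgrow.const_mul_atTop (by linarith)
    obtain ⟨R, hR1, hR2, hR3⟩ := ((hlim.eventually (eventually_gt_atTop (d / a * s₀ ^ a + C'))).and
      ((eventually_ge_atTop s₀).and (eventually_ge_atTop 1))).exists
    have := (hlow R hR2).trans (hC' R hR3)
    linarith

/-! ### Entire functions with prescribed zeros -/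

lemma eventually_countingFunction_le {z : ℕ → ℂ} {t t' : ℝ} {δ : EReal} (hd : HasDensity z t δ)
    (ht : t < t') : ∀ᶠ R : ℝ in atTop, (countingFunction z R : ℝ) ≤ R ^ t' := by
  have h : limsup (fun R : ℝ =>
      ((Real.log (countingFunction z R : ℝ) / Real.log R : ℝ) : EReal)) atTop < (t' : EReal) := by
    rw [hd.limsup_eq]
    exact_mod_cast ht
  filter_upwards [eventually_lt_of_limsup_lt h, eventually_gt_atTop 1] with R hR hR1
  have hR0 : 0 < R := by linarith
  rcases Nat.eq_zero_or_pos (countingFunction z R) with h0 | h0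
  · rw [h0, Nat.cast_zero]
    positivity
  · rw [EReal.coe_lt_coe_iff, div_lt_iff₀ (Real.log_pos hR1), ← Real.log_rpow hR0] at hR
    have hpos : (0 : ℝ) < countingFunction z R := by exact_mod_cast h0
    exact ((Real.log_lt_log_iff hpos (Real.rpow_pos_of_pos hR0 _)).1 hR).le

/-- Dyadic shells: eventually at most `2 ^ (j t')` points lie in `|z| < 2 ^ j`, each charged `2 ^ τ
* 2 ^ (-j τ)`, with `t < t' < τ`. -/
lemma summable_inv_norm_rpow {z : ℕ → ℂ} {t τ : ℝ} {δ : EReal} (hd : HasDensity z t δ)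
    (hτ0 : 0 < τ) (hτ : t < τ) : Summable fun N => (‖z N‖⁻¹) ^ τ := by
  obtain ⟨t', h1, h2⟩ := exists_between hτ
  have hz := hd.tendsto_norm
  set q : ℝ := 2 ^ (-τ) with hq
  have hq0 : 0 < q := by positivity
  have hpow : Tendsto (fun j : ℕ => (2 : ℝ) ^ j) atTop atTop :=
    tendsto_pow_atTop_atTop_of_one_lt one_lt_two
  have hs : Summable fun j : ℕ => (countingFunction z (2 ^ j) : ℝ) * (2 ^ τ * q ^ j) := by
    have hr : (2 : ℝ) ^ (t' - τ) < 1 := Real.rpow_lt_one_of_one_lt_of_neg one_lt_two (by linarith)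
    have hg := (summable_geometric_of_lt_one (by positivity) hr).mul_left ((2 : ℝ) ^ τ)
    refine Summable.of_norm_bounded_eventually_nat hg ?_
    filter_upwards [hpow.eventually (eventually_countingFunction_le hd h1)] with j hj
    rw [Real.norm_of_nonneg (by positivity)]
    have e : ((2 : ℝ) ^ j) ^ t' * q ^ j = (2 ^ (t' - τ)) ^ j := by
      rw [hq, ← Real.rpow_natCast, ← Real.rpow_natCast, ← Real.rpow_natCast,
        ← Real.rpow_mul zero_le_two, ← Real.rpow_mul zero_le_two, ← Real.rpow_mul zero_le_two,
        ← Real.rpow_add two_pos]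
      congr 1
      ring
    calc (countingFunction z (2 ^ j) : ℝ) * (2 ^ τ * q ^ j)
        ≤ (2 ^ j) ^ t' * (2 ^ τ * q ^ j) := by gcongr
      _ = 2 ^ τ * (2 ^ (t' - τ)) ^ j := by rw [← e]; ring
  set f : ℕ → ENNReal := fun N => if ‖z N‖ < 1 then 0 else ENNReal.ofReal ((‖z N‖⁻¹) ^ τ) with hf
  have hle : ∀ N, f N ≤ ∑' j : ℕ, {N | ‖z N‖ < 2 ^ j}.indicator
      (fun _ => ENNReal.ofReal (2 ^ τ * q ^ j)) N := by
    intro N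
    simp only [hf]
    split_ifs with h
    · exact zero_le
    · have h1N : 1 ≤ ‖z N‖ := not_lt.1 h
      obtain ⟨j, hj1, hj2⟩ := exists_nat_pow_near h1N one_lt_two
      refine le_trans ?_ (ENNReal.le_tsum (j + 1))
      rw [Set.indicator_of_mem (show N ∈ {N | ‖z N‖ < 2 ^ (j + 1)} from hj2)]
      apply ENNReal.ofReal_le_ofReal
      have e : (2 : ℝ) ^ τ * q ^ (j + 1) = (((2 : ℝ) ^ j)⁻¹) ^ τ := by
        rw [hq, ← Real.rpow_natCast, ← Real.rpow_natCast, ← Real.rpow_mul zero_le_two,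
          ← Real.rpow_neg zero_le_two, ← Real.rpow_mul zero_le_two, ← Real.rpow_add two_pos]
        congr 1
        push_cast
        ring
      rw [e]
      gcongr
  have hsum : ∑' N, f N ≠ ⊤ := by
    refine ne_top_of_le_ne_top ?_ (ENNReal.tsum_le_tsum hle)
    rw [ENNReal.tsum_comm]
    refine ne_top_of_le_ne_top hs.tsum_ofReal_ne_top (ENNReal.tsum_le_tsum fun j => ?_)
    have hfin := finite_norm_lt hz (2 ^ j)
    rw [tsum_eq_sum (s := hfin.toFinset) fun N hN => Set.indicator_of_notMem (by simpa using hN) _,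
      Finset.sum_congr rfl fun N hN => Set.indicator_of_mem (by simpa using hN) _,
      Finset.sum_const, nsmul_eq_mul, countingFunction, Set.ncard_eq_toFinset_card _ hfin,
      ENNReal.ofReal_mul (Nat.cast_nonneg _), ENNReal.ofReal_natCast]
  refine Summable.of_norm_bounded_eventually_nat (ENNReal.summable_toReal hsum) ?_
  filter_upwards [hz.eventually (eventually_ge_atTop 1)] with N hN
  simp only [hf]
  rw [if_neg (not_lt.2 hN), ENNReal.toReal_ofReal (by positivity),
    Real.norm_of_nonneg (by positivity)]

/-- This makes the product below grow with exponent `τ` rather than with the integer `m`. -/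
lemma one_add_pow_le_exp {y τ : ℝ} {m : ℕ} (hy : 0 ≤ y) (hτ : 0 < τ) (hm : τ ≤ m) :
    1 + y ^ m ≤ Real.exp ((1 + m / τ) * y ^ τ) := by
  have hm0 : 0 ≤ (m : ℝ) / τ := by positivity
  rcases le_total y 1 with h | h
  · have h1 : y ^ m ≤ y ^ τ := by
      rw [← Real.rpow_natCast]
      rcases hy.eq_or_lt with rfl | hy
      · rw [Real.zero_rpow hτ.ne', Real.zero_rpow (hτ.trans_le hm).ne']
      · exact Real.rpow_le_rpow_of_exponent_ge hy h hm
    have h2 := Real.add_one_le_exp ((1 + m / τ) * y ^ τ)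
    have h3 : 0 ≤ y ^ τ := by positivity
    nlinarith
  · have hy0 : 0 < y := by linarith
    have h1 : 1 ≤ y ^ τ := Real.one_le_rpow h hτ.le
    have h2 : Real.log y ≤ y ^ τ / τ := Real.log_le_rpow_div hy hτ
    have h3 : 1 ≤ y ^ m := one_le_pow₀ h
    calc 1 + y ^ m ≤ 2 * y ^ m := by linarith
      _ ≤ Real.exp 1 * Real.exp (m * Real.log y) := by
          rw [Real.exp_nat_mul, Real.exp_log hy0]
          gcongr
          have := Real.add_one_le_exp (1 : ℝ)
          linarith
      _ ≤ Real.exp ((1 + m / τ) * y ^ τ) := by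
          rw [← Real.exp_add]
          apply Real.exp_le_exp.2
          have h4 := mul_le_mul_of_nonneg_left h2 (Nat.cast_nonneg m : (0 : ℝ) ≤ m)
          have h5 : (m : ℝ) * (y ^ τ / τ) = m / τ * y ^ τ := by ring
          linarith

/-- The factors `1 - (x / w N) ^ m` with `m = ⌈τ⌉₊` replace Weierstrass factors. Their extra zeros
are harmless, since only vanishing at the `w N` is wanted. -/
lemma exists_canonical_product {w : ℕ → ℂ} {τ : ℝ} (hτ : 0 < τ)
    (hs : Summable fun N => (‖w N‖⁻¹) ^ τ) :
    ∃ P : ℂ → ℂ, Differentiable ℂ P ∧ P 0 = 1 ∧ (∀ N, w N ≠ 0 → P (w N) = 0) ∧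
      ∃ K : ℝ, 0 ≤ K ∧ ∀ x, ‖P x‖ ≤ Real.exp (K * ‖x‖ ^ τ) := by
  set m := ⌈τ⌉₊ with hmdef
  have hm : τ ≤ m := Nat.le_ceil τ
  have hm0 : m ≠ 0 := (Nat.ceil_pos.2 hτ).ne'
  have hsm : Summable fun N => (‖w N‖⁻¹) ^ m := by
    refine Summable.of_norm_bounded_eventually_nat hs ?_
    filter_upwards [hs.tendsto_atTop_zero.eventually (gt_mem_nhds one_pos)] with N hN
    have h0 : 0 ≤ ‖w N‖⁻¹ := by positivity
    have h1 : ‖w N‖⁻¹ ≤ 1 := by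
      by_contra h
      exact absurd hN (not_lt.2 (Real.one_le_rpow (not_le.1 h).le hτ.le))
    rw [Real.norm_of_nonneg (by positivity), ← Real.rpow_natCast]
    rcases h0.eq_or_lt with h | h
    · rw [← h, Real.zero_rpow hτ.ne', Real.zero_rpow (hτ.trans_le hm).ne']
    · exact Real.rpow_le_rpow_of_exponent_ge h h1 hm
  -- If `w N = 0`, division by zero gives 0 and the factor is 1.
  set f : ℕ → ℂ → ℂ := fun N x => -(x / w N) ^ m with hf
  have hnorm : ∀ N x, ‖f N x‖ = (‖x‖ * ‖w N‖⁻¹) ^ m := fun N x => by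
    simp [hf, div_eq_mul_inv]
  have hdiff : ∀ N, Differentiable ℂ (f N) := fun N => by
    simp only [hf]
    fun_prop
  have hprod : ∀ r : ℝ, HasProdLocallyUniformlyOn (fun N x => 1 + f N x)
      (fun x => ∏' N, (1 + f N x)) (Metric.ball 0 r) := by
    intro r
    have hsr := hsm.mul_left (|r| ^ m)
    refine Summable.hasProdLocallyUniformlyOn_nat_one_add Metric.isOpen_ball hsr ?_
      fun N => (hdiff N).continuous.continuousOn
    refine Eventually.of_forall fun N x hx => ?_
    rw [hnorm, mul_pow]
    have : ‖x‖ ≤ |r| := (mem_ball_zero_iff.1 hx).le.trans (le_abs_self r)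
    gcongr
  have hball : ∀ x : ℂ, x ∈ Metric.ball (0 : ℂ) (‖x‖ + 1) := fun x => by simp
  refine ⟨fun x => ∏' N, (1 + f N x), fun x => ?_, ?_, fun N hN => ?_,
    (1 + m / τ) * ∑' N, (‖w N‖⁻¹) ^ τ, ?_, fun x => ?_⟩
  · refine DifferentiableOn.differentiableAt ?_ (Metric.isOpen_ball.mem_nhds (hball x))
    refine (hprod _).differentiableOn (Eventually.of_forall fun s => ?_) Metric.isOpen_ball
    simpa [Finset.prod_fn] using DifferentiableOn.finsetProd
      fun N _ => ((hdiff N).const_add 1).differentiableOn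
  · simp [hf, hm0]
  · exact tprod_of_exists_eq_zero ⟨N, by simp [hf, hN]⟩
  · exact mul_nonneg (by positivity) (tsum_nonneg fun N => by positivity)
  · have hp := (hprod _).hasProd (hball x)
    refine le_of_tendsto' hp.norm fun s => ?_
    calc ∏ N ∈ s, ‖1 + f N x‖
        ≤ ∏ N ∈ s, Real.exp ((1 + m / τ) * (‖x‖ * ‖w N‖⁻¹) ^ τ) := by
          refine Finset.prod_le_prod (fun N _ => norm_nonneg _) fun N _ => ?_
          refine (norm_add_le _ _).trans ?_
          rw [norm_one, hnorm]
          exact one_add_pow_le_exp (by positivity) hτ hm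
      _ = Real.exp ((1 + m / τ) * (∑ N ∈ s, (‖w N‖⁻¹) ^ τ) * ‖x‖ ^ τ) := by
          rw [← Real.exp_sum, Finset.mul_sum, Finset.sum_mul]
          congr 1
          refine Finset.sum_congr rfl fun N _ => ?_
          rw [Real.mul_rpow (norm_nonneg x) (by positivity)]
          ring
      _ ≤ _ := by
          apply Real.exp_le_exp.2
          have := hs.sum_le_tsum s fun N _ => by positivity
          gcongr

lemma exists_entire_vanishing {z : ℕ → ℂ} {t a β : ℝ} {δ : EReal} (hd : HasDensity z t δ)
    (ha : 0 < a) (hta : t < a) (hβ : 0 < β) :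
    ∃ F : ℂ → ℂ, Differentiable ℂ F ∧ (∃ w, F w ≠ 0) ∧ (∀ N, F (z N) = 0) ∧
      ∃ C : ℝ, 0 < C ∧ ∀ w, ‖F w‖ ≤ C * Real.exp (β * ‖w‖ ^ a) := by
  obtain ⟨τ, hτ1, hτ2⟩ := exists_between (max_lt hta ha)
  have hτ0 : 0 < τ := (le_max_right _ _).trans_lt hτ1
  obtain ⟨P, hP, hP0, hPz, K, hK, hle⟩ := exists_canonical_product hτ0
    (summable_inv_norm_rpow hd hτ0 ((le_max_left _ _).trans_lt hτ1))
  have hFd : Differentiable ℂ fun w => w * P w := differentiable_id.mul hP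
  -- The factor `w` handles a possible point of the sequence at the origin.
  refine ⟨fun w => w * P w, hFd, ?_, fun N => ?_, ?_⟩
  · have h1 : ∀ᶠ w in 𝓝[≠] (0 : ℂ), P w ≠ 0 :=
      (hP.continuous.continuousAt.eventually_ne (by rw [hP0]; exact one_ne_zero)).filter_mono
        nhdsWithin_le_nhds
    obtain ⟨w, hw, hw0⟩ := (h1.and self_mem_nhdsWithin).exists
    exact ⟨w, mul_ne_zero hw0 hw⟩
  · rcases eq_or_ne (z N) 0 with h | h
    · simp [h]
    · simp [hPz N h]
  · refine exists_norm_le_of_eventually_maxModulus_le hFd.continuous hβ ?_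
    have hlim : Tendsto (fun R : ℝ => (τ⁻¹ + K) * R ^ (-(a - τ))) atTop (𝓝 0) := by
      simpa using (tendsto_rpow_neg_atTop (show 0 < a - τ by linarith)).const_mul (τ⁻¹ + K)
    filter_upwards [hlim.eventually (gt_mem_nhds hβ), eventually_gt_atTop 0] with R hR hR0
    refine maxModulus_le hR0.le fun w hw => ?_
    have h1 : R ≤ Real.exp (τ⁻¹ * R ^ τ) := by
      rw [← Real.log_le_iff_le_exp hR0, mul_comm, ← div_eq_mul_inv]
      exact Real.log_le_rpow_div hR0.le hτ0
    have h2 := hle w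
    rw [hw] at h2
    rw [norm_mul, hw]
    calc R * ‖P w‖ ≤ Real.exp (τ⁻¹ * R ^ τ) * Real.exp (K * R ^ τ) := by gcongr
      _ ≤ Real.exp (β * R ^ a) := by
          rw [← Real.exp_add]
          apply Real.exp_le_exp.2
          have e : R ^ τ = R ^ (-(a - τ)) * R ^ a := by
            rw [← Real.rpow_add hR0]; congr 1; ring
          have h3 := mul_le_mul_of_nonneg_right hR.le (Real.rpow_pos_of_pos hR0 a).le
          rw [← add_mul, e, ← mul_assoc]
          exact h3

/-! ### Completeness of sequences of coherent states -/

section Completeness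

variable {H : Type*} [NormedAddCommGroup H] [InnerProductSpace ℂ H]
  {ρ : ℕ → ℝ} {W : ℝ → ℝ} {a b : ℝ}

lemma norm_inner_div_sq_mul (e : HilbertBasis ℕ ℂ H) (hρ : IsAdmissible ρ) (s : H) (n : ℕ) :
    ‖inner ℂ s (e n) / ((Real.sqrt (ρ n) : ℝ) : ℂ)‖ ^ 2 * ρ n = ‖inner ℂ s (e n)‖ ^ 2 := by
  have := hρ.pos n
  rw [norm_div, Complex.norm_real, Real.norm_eq_abs, div_pow, sq_abs, Real.sq_sqrt this.le]
  field_simp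

lemma isOvercomplete_range_coherentState (e : HilbertBasis ℕ ℂ H) (hρ : IsAdmissible ρ)
    (hW : IsWeight ρ W) (ha : 0 < a) (hb : 0 < b)
    (h : LogAsymptotic (fun R : ℝ => W (R ^ 2)) (fun R : ℝ => Real.exp (-2 * b * R ^ a)))
    {z : ℕ → ℂ} {t : ℝ} {δ : EReal} (hd : HasDensity z t δ) (hinj : Function.Injective z)
    (hlt : DensityLT (a, ((b * a : ℝ) : EReal)) (t, δ)) :
    IsOvercomplete (Set.range fun N => coherentState e ρ (z N)) := by
  have key : IsTotal ((Set.range fun N => coherentState e ρ (z N)) \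
      {coherentState e ρ (z 0)}) := by
    rintro ⟨s, hs1, hs⟩
    set c : ℕ → ℂ := fun n => inner ℂ s (e n) / ((Real.sqrt (ρ n) : ℝ) : ℂ) with hc
    have hK : ∀ n : ℕ, ‖c n‖ ^ 2 * ρ n ≤ 1 * ((n : ℝ) + 1) ^ 2 := by
      intro n
      rw [hc, norm_inner_div_sq_mul e hρ]
      have h1 : ‖inner ℂ s (e n)‖ ≤ 1 := by
        refine (norm_inner_le_norm s (e n)).trans ?_
        rw [hs1, e.orthonormal.1 n, one_mul]
      have h2 : ‖inner ℂ s (e n)‖ ^ 2 ≤ 1 := pow_le_one₀ (norm_nonneg _) h1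
      nlinarith [(Nat.cast_nonneg n : (0 : ℝ) ≤ n)]
    have hbound := fun β (hβ : b < β) =>
      exists_norm_tsum_le_of_moment_bound hρ.pos hW ha hb h hK hβ
    obtain ⟨C, -, hC⟩ := hbound (b + 1) (by linarith)
    have hsum : ∀ w, HasSum (fun n => c n * w ^ n) (∑' n, c n * w ^ n) :=
      fun w => (hC w).1.hasSum
    have hzero := eq_zero_of_zeros_of_density (differentiable_of_hasSum hsum) ha hb
      (fun β hβ => by
        obtain ⟨C, hC0, hC⟩ := hbound β hβ
        exact ⟨C, hC0, fun w => (hC w).2⟩) hd hinj hlt fun N hN => by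
          refine (inner_coherentState_eq_zero_iff e hρ (z N) s).1
            (hs _ ⟨⟨N, rfl⟩, fun hmem => hN (hinj (coherentState_injective e hρ hmem))⟩)
    -- Cauchy's estimate with `M = 0` kills every coefficient of the vanishing function.
    have hcoef : ∀ n, inner ℂ s (e n) = 0 := by
      intro n
      have h1 := norm_coeff_le_of_norm_le hsum n one_pos (M := 0)
        fun w _ => by rw [hzero w, norm_zero]
      rw [one_pow, mul_one] at h1
      have h2 : c n = 0 := norm_le_zero_iff.1 h1
      have h3 : ((Real.sqrt (ρ n) : ℝ) : ℂ) ≠ 0 := by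
        exact_mod_cast (Real.sqrt_pos.2 (hρ.pos n)).ne'
      exact (div_eq_zero_iff.1 h2).resolve_right h3
    have hrepr : e.repr s = 0 := by
      ext n
      rw [e.repr_apply_apply, inner_eq_zero_symm.1 (hcoef n)]
      rfl
    have hs0 : s = 0 := e.repr.map_eq_zero_iff.1 hrepr
    rw [hs0, norm_zero] at hs1
    exact zero_ne_one hs1
  refine ⟨fun ⟨s, hs1, hs⟩ => key ⟨s, hs1, fun u hu => hs u hu.1⟩, _, ⟨0, rfl⟩, key⟩

lemma isUndercomplete_range_coherentState (e : HilbertBasis ℕ ℂ H) (hρ : IsAdmissible ρ)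
    (hW : IsWeight ρ W) (ha : 0 < a) (hb : 0 < b)
    (h : LogAsymptotic (fun R : ℝ => W (R ^ 2)) (fun R : ℝ => Real.exp (-2 * b * R ^ a)))
    {z : ℕ → ℂ} {t : ℝ} {δ : EReal} (hd : HasDensity z t δ) (hta : t < a) :
    IsUndercomplete (Set.range fun N => coherentState e ρ (z N)) := by
  obtain ⟨F, hF, ⟨w, hw⟩, hzero, C, -, hle⟩ := exists_entire_vanishing hd ha hta (half_pos hb)
  obtain ⟨c, hc⟩ := exists_hasSum_of_differentiable hF
  have hsum := summable_pow_mul_coeff_of_norm_le hρ.pos hW ha hb h hc (half_pos hb)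
    (half_lt_self hb) hle 0
  -- The conjugate compensates for the inner product being antilinear in its first argument.
  have hmem : Memℓp (fun n => (starRingEnd ℂ) (c n * ((Real.sqrt (ρ n) : ℝ) : ℂ))) 2 := by
    apply memℓp_gen
    refine hsum.congr fun n => ?_
    rw [RCLike.norm_conj, norm_mul, Complex.norm_real, Real.norm_eq_abs,
      abs_of_nonneg (Real.sqrt_nonneg _), pow_zero, one_mul]
    norm_num
    rw [mul_pow, Real.sq_sqrt (hρ.pos n).le]
  set s : H := e.repr.symm ⟨_, hmem⟩ with hs
  have hinner : ∀ n, inner ℂ s (e n) = c n * ((Real.sqrt (ρ n) : ℝ) : ℂ) := by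
    intro n
    rw [← inner_conj_symm, ← e.repr_apply_apply, hs, LinearIsometryEquiv.apply_symm_apply]
    exact Complex.conj_conj _
  have hcoef : ∀ n, inner ℂ s (e n) / ((Real.sqrt (ρ n) : ℝ) : ℂ) = c n := by
    intro n
    have h3 : ((Real.sqrt (ρ n) : ℝ) : ℂ) ≠ 0 := by
      exact_mod_cast (Real.sqrt_pos.2 (hρ.pos n)).ne'
    rw [hinner, mul_div_cancel_right₀ _ h3]
  have hs0 : s ≠ 0 := by
    intro h0
    apply hw
    rw [← (hc w).tsum_eq]
    simp [← hcoef, h0]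
  refine ⟨((‖s‖⁻¹ : ℝ) : ℂ) • s, ?_, ?_⟩
  · rw [norm_smul, Complex.norm_real, norm_inv, norm_norm, inv_mul_cancel₀ (norm_ne_zero_iff.2 hs0)]
  · rintro _ ⟨N, rfl⟩
    simp only
    rw [inner_smul_right, (inner_coherentState_eq_zero_iff e hρ (z N) s).2, mul_zero]
    simp only [hcoef]
    rw [(hc (z N)).tsum_eq, hzero N]

end Completeness

end Bargmann

theorem mainTheorem1 {H : Type*} [NormedAddCommGroup H] [InnerProductSpace ℂ H]
    (e : HilbertBasis ℕ ℂ H)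
    (ρ : ℕ → ℝ) (hρ : Bargmann.IsAdmissible ρ)
    (W : ℝ → ℝ) (hW : Bargmann.IsWeight ρ W)
    (a b : ℝ) (ha : 0 < a) (hb : 0 < b)
    (hasymp : Bargmann.LogAsymptotic (fun R : ℝ => W (R ^ 2))
      (fun R : ℝ => Real.exp (-2 * b * R ^ a))) :
    (Bargmann.growthClassOne a b ⊆ Bargmann.bargmannSpace W ∧
      Bargmann.bargmannSpace W ⊆ Bargmann.growthClass a b ∧
      (∃ F : ℂ → ℂ, F ∈ Bargmann.growthClass a b \ Bargmann.growthClassOne a b ∧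
        F ∈ Bargmann.bargmannSpace W) ∧
      (∃ F : ℂ → ℂ, F ∈ Bargmann.growthClass a b \ Bargmann.growthClassOne a b ∧
        F ∉ Bargmann.bargmannSpace W)) ∧
    (∀ (z : ℕ → ℂ) (t : ℝ) (δ : EReal), Bargmann.HasDensity z t δ →
      (Function.Injective z → Bargmann.DensityLT (a, ((b * a : ℝ) : EReal)) (t, δ) →
        Bargmann.IsOvercomplete (Set.range fun N => Bargmann.coherentState e ρ (z N))) ∧
      (t < a →
        Bargmann.IsUndercomplete (Set.range fun N => Bargmann.coherentState e ρ (z N)))) :=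
  ⟨⟨Bargmann.growthClassOne_subset_bargmannSpace hρ.pos hW ha hb hasymp,
    Bargmann.bargmannSpace_subset_growthClass hρ.pos hW ha hb hasymp,
    Bargmann.exists_mem_diff_mem_bargmannSpace hρ.pos hW ha hb hasymp,
    Bargmann.exists_mem_diff_notMem_bargmannSpace hρ.pos hW ha hb hasymp⟩,
    fun _ _ _ hd => ⟨fun hinj hlt =>
      Bargmann.isOvercomplete_range_coherentState e hρ hW ha hb hasymp hd hinj hlt,
      fun hta => Bargmann.isUndercomplete_range_coherentState e hρ hW ha hb hasymp hd hta⟩⟩
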